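/- **Setting.** Let $p_1,p_2\ge 1$, $k_1\le p_1$, $k_2\le p_2$, $p=p_1+p_2$, and let $T>0$ be fixed. On a stochastic basis with usual conditions $(\Omega,\mathscr F,\{\mathscr F_t\},\mathbf P)$ with independent standard Wiener processes $W_1,\dots,W_4$ (of dimensions $r_1,\dots,r_4$), let $$d\xi_t=B_1(\xi_t)dt+S_{1,0}dW_{1,t},\quad d\delta_t=B_2(\delta_t)dt+S_{2,0}dW_{2,t},\quad d\varepsilon_t=B_3(\varepsilon_t)dt+S_{3,0}dW_{3,t},\quad d\zeta_t=B_4(\zeta_t)dt+S_{4,0}dW_{4,t}$$ with deterministic initial values, of dimensions $k_1,p_1,p_2,k_2$. Let $\eta_t=\mathbf B_0\eta_t+\mathbf\Gamma_0\xi_t+\zeta_t$ and let the observed $p$-dimensional process be $\mathbb X_t=(\Lambda_{x_1,0}\xi_t+\delta_t,\ \Lambda_{x_2,0}\eta_t+\varepsilon_t)$, observed at $t_i^n=ih_n$, $h_n=T/n$, $0\le i\le n$. For any set of matrices $(\Lambda_{x_1},\Lambda_{x_2},\mathbf B,\mathbf\Gamma,S_1,\dots,S_4)$ of the corresponding sizes,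 put $\Psi=I-\mathbf B$, $\Sigma_{\xi\xi}=S_1S_1^\top$, $\Sigma_{\delta\delta}=S_2S_2^\top$, $\Sigma_{\varepsilon\varepsilon}=S_3S_3^\top$, $\Sigma_{\zeta\zeta}=S_4S_4^\top$; call the set admissible if $\mathbf B$ has zero diagonal, $\Lambda_{x_1}$ has full column rank, $\Psi$ is non-singular, and $\Sigma_{\delta\delta},\Sigma_{\varepsilon\varepsilon}$ are positive definite; and let $\Sigma$ be the symmetric matrix with blocks $$\Sigma^{11}=\Lambda_{x_1}\Sigma_{\xi\xi}\Lambda_{x_1}^\top+\Sigma_{\delta\delta},\quad \Sigma^{12}=\Lambda_{x_1}\Sigma_{\xi\xi}\mathbf\Gamma^\top\Psi^{-1\top}\Lambda_{x_2}^\top,\quad \Sigma^{22}=\Lambda_{x_2}\Psi^{-1}(\mathbf\Gamma\Sigma_{\xi\xi}\mathbf\Gamma^\top+\Sigma_{\zeta\zeta})\Psi^{-1\top}\Lambda_{x_2}^\top+\Sigma_{\varepsilon\varepsilon}.$$ The true set of matrices is admissible, with variance matrix $\Sigma_0$. For $m=1,\dots,M$, Model $m$ has a convex compact parameter set $\Theta_m\subset\mathbb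 R^{q_m}$ with non-empty interior and an admissible set of matrices depending on $\theta_m\in\Theta_m$, whose variance matrix $\Sigma_m(\theta_m)$ is twice continuously differentiable on $\Theta_m$. Write $A[B]=\mathrm{tr}(AB^\top)$ and $$\mathbb L_{m,n}(\theta)=\prod_{i=1}^n\frac{1}{(2\pi h_n)^{p/2}\det\Sigma_m(\theta)^{1/2}}\exp\Bigl(-\frac1{2h_n}\Sigma_m(\theta)^{-1}\bigl[\Delta_i\mathbb X\,\Delta_i\mathbb X^\top\bigr]\Bigr),\qquad \mathbb H_{m,n}(\theta)=\log\bigl\{(2\pi h_n)^{np/2}\mathbb L_{m,n}(\theta)\bigr\},$$ where $\Delta_i\mathbb X=\mathbb X_{t_i^n}-\mathbb X_{t_{i-1}^n}$. Let $\hat\theta_{m,n}$ be a maximizer of $\mathbb L_{m,n}$ over $\Theta_m$, and define $$\mathrm{QBIC}^{(m)}_{1,n}=-2\mathbb H_{m,n}(\hat\theta_{m,n})+\log\det\bigl(n\tilde\Gamma_{m,n}\bigr),\qquad \mathrm{QBIC}^{(m)}_{2,n}=-2\mathbb H_{m,n}(\hat\theta_{m,n})+q_m\log n,$$ where $\tilde\Gamma_{m,n}=-n^{-1}\partial^2_{\theta_m}\mathbb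 H_{m,n}(\hat\theta_{m,n})$ if this matrix is positive definite, and $\tilde\Gamma_{m,n}=I_{q_m}$ otherwise. Let $\pi_{m,n}$ be prior densities on $\Theta_m$. Let $\mathfrak M$ be the set of correctly specified models, i.e. those $m$ for which $\Sigma_0=\Sigma_m(\theta_{m,0})$ for some $\theta_{m,0}\in\Theta_m$; for $m\in\mathfrak M$ it is assumed that $\theta_{m,0}$ lies in the interior of $\Theta_m$. The optimal model $m^*$ is the model in $\mathfrak M$ of smallest dimension $q_m$, assumed unique. Model $i$ is nested in Model $j$ if $q_i<q_j$ and there are $F\in\mathbb R^{q_j\times q_i}$ with $F^\top F=I$ and $c\in\mathbb R^{q_j}$ such that $F\theta+c\in\Theta_j$ and $\mathbb H_{i,n}(\theta)=\mathbb H_{j,n}(F\theta+c)$ for all $\theta\in\Theta_i$ and all $n$. **Assumptions.** [A] Each pair (drift, process) among $(B_1,\xi),(B_2,\delta),(B_3,\varepsilon),(B_4,\zeta)$ satisfies: the drift is globally Lipschitz; $\sup_{t\ge0}\mathbf E|\cdot_t|^\ell<\infty$ for all $\ell>0$; the drift is four times continuously differentiable, and it and its derivatives up to order four have polynomial growth.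 [B] For $m\in\mathfrak M$: $\inf_n\pi_{m,n}(\theta_{m,0})>0$, $\sup_{\theta\in\Theta_m}\sup_n\pi_{m,n}(\theta)<\infty$, and for each $L>0$, $\sup|\pi_{m,n}(\theta_{m,0}+n^{-1/2}u)-\pi_{m,n}(\theta_{m,0})|\to0$ as $n\to\infty$, the supremum being over $|u|<L$ with $\theta_{m,0}+n^{-1/2}u\in\Theta_m$. [C1] For $m\in\mathfrak M$: (a) there is $\chi>0$ such that for all $\theta\in\Theta_m$ $$-\tfrac12\bigl(\Sigma_m(\theta)^{-1}-\Sigma_m(\theta_{m,0})^{-1}\bigr)\bigl[\Sigma_m(\theta_{m,0})\bigr]-\tfrac12\log\frac{\det\Sigma_m(\theta)}{\det\Sigma_m(\theta_{m,0})}\le-\chi|\theta-\theta_{m,0}|^2;$$ (b) the Jacobian matrix of $\theta\mapsto\mathrm{vech}\,\Sigma_m(\theta)$ at $\theta_{m,0}$ has rank $q_m$. **Theorem.** Assume [A], [B] and [C1], and let $m\in\mathfrak M\setminus\{m^*\}$ be such that Model $m^*$ is nested in Model $m$. Then, as $n\to\infty$, $$\mathbf P\bigl(\mathrm{QBIC}^{(m^*)}_{1,n}<\mathrm{QBIC}^{(m)}_{1,n}\bigr)\to1\qquad\text{and}\qquad\mathbf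 P\bigl(\mathrm{QBIC}^{(m^*)}_{2,n}<\mathrm{QBIC}^{(m)}_{2,n}\bigr)\to1 .$$ -/

import Mathlib

open MeasureTheory ProbabilityTheory Filter Topology Matrix
open scoped NNReal ENNReal

noncomputable section

/-! ### Dimensions and coefficients of the structural equation model -/

/-- The dimensions: `k₁, k₂` of the common factors, `p₁, p₂` of the observed vectors,
`r₁, …, r₄` of the driving Wiener processes. -/
structure SEMDims where
  k₁ : ℕ
  p₁ : ℕ
  k₂ : ℕ
  p₂ : ℕ
  r₁ : ℕ
  r₂ : ℕ
  r₃ : ℕ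
  r₄ : ℕ
  p₁_pos : 0 < p₁
  p₂_pos : 0 < p₂
  k₁_le : k₁ ≤ p₁
  k₂_le : k₂ ≤ p₂

/-- The set of coordinates of the observed vector `(X₁, X₂)`. -/
abbrev SEMDims.Obs (D : SEMDims) : Type := Fin D.p₁ ⊕ Fin D.p₂

/-- `p = p₁ + p₂`. -/
def SEMDims.p (D : SEMDims) : ℕ := D.p₁ + D.p₂

/-- A set of loading matrices and diffusion coefficients. -/
structure SEMCoeff (D : SEMDims) where
  Λ₁ : Matrix (Fin D.p₁) (Fin D.k₁) ℝ
  Λ₂ : Matrix (Fin D.p₂) (Fin D.k₂) ℝ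
  B : Matrix (Fin D.k₂) (Fin D.k₂) ℝ
  Γ : Matrix (Fin D.k₂) (Fin D.k₁) ℝ
  S₁ : Matrix (Fin D.k₁) (Fin D.r₁) ℝ
  S₂ : Matrix (Fin D.p₁) (Fin D.r₂) ℝ
  S₃ : Matrix (Fin D.p₂) (Fin D.r₃) ℝ
  S₄ : Matrix (Fin D.k₂) (Fin D.r₄) ℝ

namespace SEMCoeff

variable {D : SEMDims} (a : SEMCoeff D)

/-- `Ψ = I - B`. -/
def Ψ : Matrix (Fin D.k₂) (Fin D.k₂) ℝ := 1 - a.B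

def covξξ : Matrix (Fin D.k₁) (Fin D.k₁) ℝ := a.S₁ * a.S₁ᵀ
def covδδ : Matrix (Fin D.p₁) (Fin D.p₁) ℝ := a.S₂ * a.S₂ᵀ
def covεε : Matrix (Fin D.p₂) (Fin D.p₂) ℝ := a.S₃ * a.S₃ᵀ
def covζζ : Matrix (Fin D.k₂) (Fin D.k₂) ℝ := a.S₄ * a.S₄ᵀ

/-- The standing conditions on the coefficients. -/
structure Admissible : Prop where
  diag_B : ∀ i, a.B i i = 0
  rank_Λ₁ : a.Λ₁.rank = D.k₁
  Ψ_nonsing : IsUnit a.Ψ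
  covδδ_pos : a.covδδ.PosDef
  covεε_pos : a.covεε.PosDef

def cov₁₁ : Matrix (Fin D.p₁) (Fin D.p₁) ℝ :=
  a.Λ₁ * a.covξξ * a.Λ₁ᵀ + a.covδδ

def cov₁₂ : Matrix (Fin D.p₁) (Fin D.p₂) ℝ :=
  a.Λ₁ * a.covξξ * a.Γᵀ * (a.Ψ⁻¹)ᵀ * a.Λ₂ᵀ

def cov₂₂ : Matrix (Fin D.p₂) (Fin D.p₂) ℝ :=
  a.Λ₂ * a.Ψ⁻¹ * (a.Γ * a.covξξ * a.Γᵀ + a.covζζ) * (a.Ψ⁻¹)ᵀ * a.Λ₂ᵀ + a.covεε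

/-- The variance matrix `Σ` of the observed process. -/
def cov : Matrix D.Obs D.Obs ℝ :=
  Matrix.fromBlocks a.cov₁₁ a.cov₁₂ a.cov₁₂ᵀ a.cov₂₂

end SEMCoeff

/-! ### Stochastic basis, Wiener processes, diffusions -/

section Processes

variable {Ω : Type*} [mΩ : MeasurableSpace Ω]

/-- The usual conditions: right-continuity, and all null sets lie in `𝓕 0`. -/
structure UsualConditions (P : Measure Ω) (𝓕 : Filtration ℝ≥0 mΩ) : Prop where
  rightCont : 𝓕.IsRightContinuous
  complete : ∀ s : Set Ω, P s = 0 → MeasurableSet[𝓕 0] s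

/-- `W` is an `r`-dimensional standard Wiener process relative to the filtration `𝓕`. -/
structure IsWiener (P : Measure Ω) (𝓕 : Filtration ℝ≥0 mΩ) {r : ℕ}
    (W : ℝ≥0 → Ω → EuclideanSpace ℝ (Fin r)) : Prop where
  adapted : Adapted 𝓕 W
  brownian : ∀ j, IsBrownianReal (fun t ω => W t ω j) P
  indep_coord : iIndepFun (fun (j : Fin r) (ω : Ω) (t : ℝ≥0) => W t ω j) P
  indep_past : ∀ s t : ℝ≥0, s ≤ t →
    Indep (MeasurableSpace.comap (fun ω => W t ω - W s ω) inferInstance) (𝓕 s) P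

/-- The σ-algebra generated by a process. -/
abbrev pathSigma {r : ℕ} (W : ℝ≥0 → Ω → EuclideanSpace ℝ (Fin r)) : MeasurableSpace Ω :=
  MeasurableSpace.comap (fun (ω : Ω) (t : ℝ≥0) => W t ω) inferInstance

/-- `Z` solves `dZ_t = b(Z_t) dt + S dW_t`, `Z_0 = c`. Since `S` is a constant matrix and
`W_0 = 0`, the stochastic integral `∫₀ᵗ S dW` is `S W_t`. -/
structure IsDiffusion (P : Measure Ω) (𝓕 : Filtration ℝ≥0 mΩ) {d r : ℕ}
    (b : EuclideanSpace ℝ (Fin d) → EuclideanSpace ℝ (Fin d)) (S : Matrix (Fin d) (Fin r) ℝ)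
    (c : EuclideanSpace ℝ (Fin d)) (W : ℝ≥0 → Ω → EuclideanSpace ℝ (Fin r))
    (Z : ℝ≥0 → Ω → EuclideanSpace ℝ (Fin d)) : Prop where
  adapted : Adapted 𝓕 Z
  continuous_paths : ∀ᵐ ω ∂P, Continuous fun t => Z t ω
  sde : ∀ᵐ ω ∂P, ∀ t : ℝ≥0,
    Z t ω = c + (∫ s in (0 : ℝ)..t, b (Z s.toNNReal ω)) + WithLp.toLp 2 (S *ᵥ (W t ω).ofLp)

/-- `f ∈ C^k_↑`: `f` is `k` times continuously differentiable, and `f` and its derivatives up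
to order `k` are of polynomial growth. -/
def PolyGrowthContDiff {d d' : ℕ} (k : ℕ)
    (f : EuclideanSpace ℝ (Fin d) → EuclideanSpace ℝ (Fin d')) : Prop :=
  ContDiff ℝ k f ∧ ∀ j ≤ k, ∃ C : ℝ, 0 < C ∧ ∀ x, ‖iteratedFDeriv ℝ j f x‖ ≤ C * (1 + ‖x‖) ^ C

/-- The regularity and moment condition on one diffusion: Lipschitz drift, moments of every order
bounded uniformly in time, and drift in `C⁴_↑`. -/
structure DiffusionCondition (P : Measure Ω) {d : ℕ}
    (b : EuclideanSpace ℝ (Fin d) → EuclideanSpace ℝ (Fin d))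
    (Z : ℝ≥0 → Ω → EuclideanSpace ℝ (Fin d)) : Prop where
  lipschitz : ∃ C : ℝ, 0 < C ∧ ∀ x y, ‖b x - b y‖ ≤ C * ‖x - y‖
  moments : ∀ ℓ : ℝ, 0 < ℓ → ⨆ t : ℝ≥0, ∫⁻ ω, ‖Z t ω‖ₑ ^ ℓ ∂P < ∞
  smooth : PolyGrowthContDiff 4 b

end Processes

/-- The true model: coefficients, a filtered probability space with four independent Wiener
processes, and the latent processes `ξ, δ, ε, ζ` (diffusions) and `η` (structural equation). -/
structure TrueSEM (D : SEMDims) {Ω : Type*} [mΩ : MeasurableSpace Ω] (P : Measure Ω) where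
  coeff : SEMCoeff D
  admissible : coeff.Admissible
  𝓕 : Filtration ℝ≥0 mΩ
  usual : UsualConditions P 𝓕
  W₁ : ℝ≥0 → Ω → EuclideanSpace ℝ (Fin D.r₁)
  W₂ : ℝ≥0 → Ω → EuclideanSpace ℝ (Fin D.r₂)
  W₃ : ℝ≥0 → Ω → EuclideanSpace ℝ (Fin D.r₃)
  W₄ : ℝ≥0 → Ω → EuclideanSpace ℝ (Fin D.r₄)
  wiener₁ : IsWiener P 𝓕 W₁
  wiener₂ : IsWiener P 𝓕 W₂
  wiener₃ : IsWiener P 𝓕 W₃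
  wiener₄ : IsWiener P 𝓕 W₄
  indep : iIndep ![pathSigma W₁, pathSigma W₂, pathSigma W₃, pathSigma W₄] P
  b₁ : EuclideanSpace ℝ (Fin D.k₁) → EuclideanSpace ℝ (Fin D.k₁)
  b₂ : EuclideanSpace ℝ (Fin D.p₁) → EuclideanSpace ℝ (Fin D.p₁)
  b₃ : EuclideanSpace ℝ (Fin D.p₂) → EuclideanSpace ℝ (Fin D.p₂)
  b₄ : EuclideanSpace ℝ (Fin D.k₂) → EuclideanSpace ℝ (Fin D.k₂)
  c₁ : EuclideanSpace ℝ (Fin D.k₁)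
  c₂ : EuclideanSpace ℝ (Fin D.p₁)
  c₃ : EuclideanSpace ℝ (Fin D.p₂)
  c₄ : EuclideanSpace ℝ (Fin D.k₂)
  ξ : ℝ≥0 → Ω → EuclideanSpace ℝ (Fin D.k₁)
  δ : ℝ≥0 → Ω → EuclideanSpace ℝ (Fin D.p₁)
  ε : ℝ≥0 → Ω → EuclideanSpace ℝ (Fin D.p₂)
  ζ : ℝ≥0 → Ω → EuclideanSpace ℝ (Fin D.k₂)
  η : ℝ≥0 → Ω → EuclideanSpace ℝ (Fin D.k₂)
  sde_ξ : IsDiffusion P 𝓕 b₁ coeff.S₁ c₁ W₁ ξ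
  sde_δ : IsDiffusion P 𝓕 b₂ coeff.S₂ c₂ W₂ δ
  sde_ε : IsDiffusion P 𝓕 b₃ coeff.S₃ c₃ W₃ ε
  sde_ζ : IsDiffusion P 𝓕 b₄ coeff.S₄ c₄ W₄ ζ
  structural : ∀ t ω, (η t ω).ofLp =
    coeff.B *ᵥ (η t ω).ofLp + coeff.Γ *ᵥ (ξ t ω).ofLp + (ζ t ω).ofLp

namespace TrueSEM

variable {D : SEMDims} {Ω : Type*} [MeasurableSpace Ω] {P : Measure Ω} (S : TrueSEM D P)

/-- The observed path `t ↦ X_t(ω) = (Λ₁ ξ_t + δ_t, Λ₂ η_t + ε_t)`. -/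
def path (ω : Ω) (t : ℝ≥0) : D.Obs → ℝ :=
  Sum.elim (S.coeff.Λ₁ *ᵥ (S.ξ t ω).ofLp + (S.δ t ω).ofLp)
    (S.coeff.Λ₂ *ᵥ (S.η t ω).ofLp + (S.ε t ω).ofLp)

/-- Condition [A]. -/
structure ConditionA : Prop where
  cond_ξ : DiffusionCondition P S.b₁ S.ξ
  cond_δ : DiffusionCondition P S.b₂ S.δ
  cond_ε : DiffusionCondition P S.b₃ S.ε
  cond_ζ : DiffusionCondition P S.b₄ S.ζ

end TrueSEM

/-! ### Parametric models and quasi-likelihood -/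

/-- A parametric model: a convex and compact parameter set with nonempty interior (such a set
automatically has a locally Lipschitz boundary), and coefficients depending on the parameter whose
variance matrix is twice continuously differentiable on the parameter set. The model enters the
statistical problem through its variance matrix only. -/
structure SEMModel (D : SEMDims) where
  q : ℕ
  Θ : Set (EuclideanSpace ℝ (Fin q))
  convex_Θ : Convex ℝ Θ
  compact_Θ : IsCompact Θ
  interior_Θ : (interior Θ).Nonempty
  coeff : EuclideanSpace ℝ (Fin q) → SEMCoeff D
  admissible : ∀ θ ∈ Θ, (coeff θ).Admissible
  smooth_cov : ∀ i j, ContDiffOn ℝ 2 (fun θ => (coeff θ).cov i j) Θ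

/-- `A[B] = tr (A Bᵀ)`. -/
def bracket {ι : Type*} [Fintype ι] (A B : Matrix ι ι ℝ) : ℝ := (A * Bᵀ).trace

/-- The step `h_n = T / n`. -/
def step (T : ℝ≥0) (n : ℕ) : ℝ≥0 := T / n

/-- The increment of a path over `[i h_n, (i + 1) h_n]`. -/
def increment {ι : Type*} (T : ℝ≥0) (n : ℕ) (x : ℝ≥0 → ι → ℝ) (i : ℕ) : ι → ℝ :=
  x ((i + 1 : ℕ) * step T n) - x (i * step T n)

/-- The index set of `vech` of a symmetric matrix: pairs on or below the diagonal. -/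
abbrev VechIdx (D : SEMDims) : Type :=
  {ij : D.Obs × D.Obs // finSumFinEquiv ij.2 ≤ finSumFinEquiv ij.1}

namespace SEMModel

variable {D : SEMDims} (m : SEMModel D)

/-- The parameter space `ℝ^{q_m}`. -/
abbrev Param : Type := EuclideanSpace ℝ (Fin m.q)

/-- `Σ_m(θ)`. -/
def cov (θ : m.Param) : Matrix D.Obs D.Obs ℝ := (m.coeff θ).cov

/-- The quasi-likelihood `L_{m,n}(θ)` of the path `x`. -/
def quasiLik (T : ℝ≥0) (x : ℝ≥0 → D.Obs → ℝ) (n : ℕ) (θ : m.Param) : ℝ :=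
  ∏ i ∈ Finset.range n,
    1 / ((2 * Real.pi * step T n) ^ ((D.p : ℝ) / 2) * √(m.cov θ).det) *
      Real.exp (-(1 / (2 * (step T n : ℝ))) *
        bracket (m.cov θ)⁻¹ (vecMulVec (increment T n x i) (increment T n x i)))

/-- `H_{m,n}(θ) = log ((2π h_n)^{np/2} L_{m,n}(θ))`. -/
def quasiLogLik (T : ℝ≥0) (x : ℝ≥0 → D.Obs → ℝ) (n : ℕ) (θ : m.Param) : ℝ :=
  Real.log ((2 * Real.pi * step T n) ^ ((n : ℝ) * D.p / 2) * m.quasiLik T x n θ)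

/-- The Hessian matrix of `H_{m,n}` with respect to the parameter. On the boundary of `Θ` the
derivatives are those relative to `Θ`; in the interior they are the usual ones. -/
def hessian (T : ℝ≥0) (x : ℝ≥0 → D.Obs → ℝ) (n : ℕ) (θ : m.Param) :
    Matrix (Fin m.q) (Fin m.q) ℝ :=
  Matrix.of fun i j => iteratedFDerivWithin ℝ 2 (m.quasiLogLik T x n) m.Θ θ
    ![EuclideanSpace.single i 1, EuclideanSpace.single j 1]

open Classical in
/-- `Γ̃_{m,n}(θ)`: the normalized observed information `-n⁻¹ ∂² H_{m,n}(θ)` if it is positive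
definite, and the identity matrix otherwise. -/
def infoMatrix (T : ℝ≥0) (x : ℝ≥0 → D.Obs → ℝ) (n : ℕ) (θ : m.Param) :
    Matrix (Fin m.q) (Fin m.q) ℝ :=
  if (-((n : ℝ)⁻¹ • m.hessian T x n θ)).PosDef then -((n : ℝ)⁻¹ • m.hessian T x n θ) else 1

/-- `QBIC₁` evaluated at the estimate `θ`. -/
def qbic₁ (T : ℝ≥0) (x : ℝ≥0 → D.Obs → ℝ) (n : ℕ) (θ : m.Param) : ℝ :=
  -2 * m.quasiLogLik T x n θ + Real.log ((n : ℝ) • m.infoMatrix T x n θ).det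

/-- `QBIC₂` evaluated at the estimate `θ`. -/
def qbic₂ (T : ℝ≥0) (x : ℝ≥0 → D.Obs → ℝ) (n : ℕ) (θ : m.Param) : ℝ :=
  -2 * m.quasiLogLik T x n θ + m.q * Real.log n

/-- `θ` maximizes the quasi-likelihood over `Θ`. -/
def IsQMLE (T : ℝ≥0) (x : ℝ≥0 → D.Obs → ℝ) (n : ℕ) (θ : m.Param) : Prop :=
  θ ∈ m.Θ ∧ IsMaxOn (m.quasiLik T x n) m.Θ θ

/-- The model is correctly specified for the true variance `V₀`. -/
def CorrectlySpecified (V₀ : Matrix D.Obs D.Obs ℝ) : Prop := ∃ θ ∈ m.Θ, V₀ = m.cov θ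

/-- `Y_m(θ)`. -/
def contrast (θ₀ θ : m.Param) : ℝ :=
  -(1 / 2) * bracket ((m.cov θ)⁻¹ - (m.cov θ₀)⁻¹) (m.cov θ₀)
    - (1 / 2) * Real.log ((m.cov θ).det / (m.cov θ₀).det)

/-- The Jacobian matrix of `θ ↦ vech Σ_m(θ)` at `θ₀`. -/
def vechJacobian (θ₀ : m.Param) : Matrix (VechIdx D) (Fin m.q) ℝ :=
  Matrix.of fun ij k =>
    fderivWithin ℝ (fun θ => m.cov θ ij.1.1 ij.1.2) m.Θ θ₀ (EuclideanSpace.single k 1)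

/-- Condition [C1] at the true parameter `θ₀`. -/
structure ConditionC1 (θ₀ : m.Param) : Prop where
  identifiable : ∃ χ : ℝ, 0 < χ ∧ ∀ θ ∈ m.Θ, m.contrast θ₀ θ ≤ -χ * ‖θ - θ₀‖ ^ 2
  full_rank : (m.vechJacobian θ₀).rank = m.q

/-- `π` is a probability density (with respect to Lebesgue measure) on `Θ`. -/
structure IsPriorDensity (π : m.Param → ℝ) : Prop where
  measurable : Measurable π
  nonneg : ∀ θ, 0 ≤ π θ
  total : ∫⁻ θ in m.Θ, ENNReal.ofReal (π θ) = 1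

/-- Condition [B] on the sequence of prior densities, at the true parameter `θ₀`. -/
structure ConditionB (π : ℕ → m.Param → ℝ) (θ₀ : m.Param) : Prop where
  lower : ∃ c : ℝ, 0 < c ∧ ∀ n, 1 ≤ n → c ≤ π n θ₀
  upper : ∃ C : ℝ, ∀ n, 1 ≤ n → ∀ θ ∈ m.Θ, π n θ ≤ C
  equicont : ∀ L : ℝ, 0 < L → ∀ e : ℝ, 0 < e → ∀ᶠ n : ℕ in atTop, ∀ u : m.Param,
    ‖u‖ < L → θ₀ + (√(n : ℝ))⁻¹ • u ∈ m.Θ → |π n (θ₀ + (√(n : ℝ))⁻¹ • u) - π n θ₀| ≤ e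

/-- Model `i` is nested in Model `j`: `q_i < q_j` and there are a matrix `F` with `Fᵀ F = I` and a
vector `c` such that `θ ↦ F θ + c` maps `Θ_i` into `Θ_j` and `H_{i,n}(θ) = H_{j,n}(F θ + c)` for
all `θ ∈ Θ_i` and all `n` (almost surely, with `X` the observed path). -/
def NestedIn {Ω : Type*} [MeasurableSpace Ω] (P : Measure Ω) (T : ℝ≥0)
    (X : Ω → ℝ≥0 → D.Obs → ℝ) (i j : SEMModel D) : Prop :=
  i.q < j.q ∧ ∃ (F : Matrix (Fin j.q) (Fin i.q) ℝ) (c : j.Param), Fᵀ * F = 1 ∧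
    (∀ θ ∈ i.Θ, WithLp.toLp 2 (F *ᵥ θ.ofLp) + c ∈ j.Θ) ∧
    ∀ n : ℕ, 1 ≤ n → ∀ᵐ ω ∂P, ∀ θ ∈ i.Θ,
      i.quasiLogLik T (X ω) n θ = j.quasiLogLik T (X ω) n (WithLp.toLp 2 (F *ᵥ θ.ofLp) + c)

end SEMModel

/-- `mstar` is the optimal model: the unique correctly specified model of smallest dimension. -/
def IsOptimalModel {D : SEMDims} {M : ℕ} (model : Fin M → SEMModel D)
    (V₀ : Matrix D.Obs D.Obs ℝ) (mstar : Fin M) : Prop :=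
  (model mstar).CorrectlySpecified V₀ ∧
    ∀ j, (model j).CorrectlySpecified V₀ → j ≠ mstar → (model mstar).q < (model j).q

end

noncomputable section

/-! ### The variance matrix and its factorization -/

/-! The quasi-log-likelihood depends on the data only through the realized covariance `Q = T⁻¹ ∑ Δ_i
X Δ_i Xᵀ`: on the parameter set, `H_n(θ) = n * rate Q θ`. The argument therefore splits into one
probabilistic fact about `Q` and a deterministic comparison on paths where `Q` is good.

The probabilistic fact is that `Q - Σ₀` is of order `n^{-1/2}` in probability
(`bddInProb_realizedCov`). The observed process is a constant matrix times a stacked Wiener process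
plus a remainder with Lipschitz paths. For the Wiener part, second moments of orthogonal sums give
the rate; increments of the remainder are `O(1/n)` with a random constant and do not spoil it.

For the deterministic part, suppose `|Q - Σ₀| ≤ r` entrywise with `r = L / √n`. Identifiability
gives `rate Q θ - rate Q θ₀ ≤ -χ s² + C r s` with `s = ‖θ - θ₀‖`. Hence the maximizer is within
`O(r)` of `θ₀`, and its log-likelihood gain `n * O(r²)` over `θ₀` is bounded
(`exists_isQMLE_control`). Two correctly specified models have the same rate at their true
parameters, so the larger model gains at most a constant. The limiting information matrix is
positive definite, so `log det` of the observed information stays bounded and both penalties equal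
`q log n + O(1)` (`exists_abs_log_det_infoMatrix_le`). Nesting supplies the gap in dimension, worth
at least `log n`, which eventually beats every constant (`eventually_qbic_lt`). -/

/-- The set of coordinates of the stacked driving Wiener process. -/
abbrev SEMDims.Noise (D : SEMDims) : Type :=
  (Fin D.r₁ ⊕ Fin D.r₂) ⊕ (Fin D.r₃ ⊕ Fin D.r₄)

namespace SEMCoeff

variable {D : SEMDims} (a : SEMCoeff D)

/-- The diffusion coefficient of the observed process with respect to the stacked Wiener
process. -/
def diffusion : Matrix D.Obs D.Noise ℝ :=
  Matrix.fromBlocks (Matrix.fromCols (a.Λ₁ * a.S₁) a.S₂) 0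
    (Matrix.fromCols (a.Λ₂ * a.Ψ⁻¹ * a.Γ * a.S₁) 0) (Matrix.fromCols a.S₃ (a.Λ₂ * a.Ψ⁻¹ * a.S₄))

lemma diffusion_mul_transpose : a.diffusion * a.diffusionᵀ = a.cov := by
  simp only [diffusion, cov, cov₁₁, cov₁₂, cov₂₂, covξξ, covδδ, covεε, covζζ,
    Matrix.fromBlocks_transpose, Matrix.fromBlocks_multiply, Matrix.transpose_fromCols,
    Matrix.fromCols_mul_fromRows, Matrix.transpose_zero, Matrix.zero_mul, Matrix.mul_zero,
    add_zero, Matrix.transpose_mul, Matrix.transpose_transpose, Matrix.mul_add, Matrix.add_mul,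
    Matrix.mul_assoc]
  congr 1
  abel

/-- The quadratic form of `A * Aᵀ` at `x` is the squared length of `x ᵥ* A`, so it cannot be
positive when that vector vanishes. -/
lemma vecMul_injective_of_posDef {m n : Type*} [Fintype m] [Fintype n]
    {A : Matrix m n ℝ} (h : (A * Aᵀ).PosDef) {x : m → ℝ} (hx : x ᵥ* A = 0) : x = 0 := by
  by_contra hne
  have := h.dotProduct_mulVec_pos hne
  rw [← Matrix.mulVec_mulVec, Matrix.dotProduct_mulVec] at this
  simp [hx] at this

/-- The noises of `δ` and `ε` each enter a single block of observed coordinates, through `S₂` and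
`S₃`. Reading `x ᵥ* diffusion = 0` on those columns alone isolates the two halves of `x`, and
positive definiteness of `covδδ` and `covεε` kills them. -/
lemma Admissible.cov_posDef {a : SEMCoeff D} (ha : a.Admissible) : a.cov.PosDef := by
  rw [← a.diffusion_mul_transpose]
  refine Matrix.PosDef.mul_conjTranspose_self a.diffusion ?_
  rw [← Matrix.coe_vecMulLinear, ← LinearMap.ker_eq_bot, LinearMap.ker_eq_bot']
  intro x hx
  rw [Matrix.vecMulLinear_apply] at hx
  have h1 : (x ∘ Sum.inl) ᵥ* a.S₂ = 0 := by
    ext j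
    simpa [diffusion, Matrix.vecMul, dotProduct] using congrFun hx (.inl (.inr j))
  have h2 : (x ∘ Sum.inr) ᵥ* a.S₃ = 0 := by
    ext j
    simpa [diffusion, Matrix.vecMul, dotProduct] using congrFun hx (.inr (.inl j))
  have h1 := vecMul_injective_of_posDef ha.covδδ_pos h1
  have h2 := vecMul_injective_of_posDef ha.covεε_pos h2
  ext (i | i)
  · exact congrFun h1 i
  · exact congrFun h2 i

end SEMCoeff

/-! ### Smoothness of determinants and inverses -/

section MatrixSmooth

variable {E ι : Type*} [NormedAddCommGroup E] [NormedSpace ℝ E] [Fintype ι] [DecidableEq ι]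
  {A : E → Matrix ι ι ℝ} {s : Set E} {n : WithTop ℕ∞}

lemma ContDiffOn.matrix_det (hA : ∀ i j, ContDiffOn ℝ n (fun x => A x i j) s) :
    ContDiffOn ℝ n (fun x => (A x).det) s := by
  simp only [Matrix.det_apply']
  exact ContDiffOn.sum fun σ _ => contDiffOn_const.mul (contDiffOn_prod fun i _ => hA _ _)

/-- Cramer's rule: each entry is a cofactor divided by the determinant, and both are polynomials in
the entries of `A`. -/
lemma ContDiffOn.matrix_inv (hA : ∀ i j, ContDiffOn ℝ n (fun x => A x i j) s)
    (h0 : ∀ x ∈ s, (A x).det ≠ 0) (i j : ι) : ContDiffOn ℝ n (fun x => (A x)⁻¹ i j) s := by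
  have h : ∀ x, (A x)⁻¹ i j = ((A x).det)⁻¹ * (A x).adjugate i j := fun x => by
    rw [Matrix.inv_def, Ring.inverse_eq_inv', Matrix.smul_apply, smul_eq_mul]
  simp only [h]
  refine ((ContDiffOn.matrix_det hA).inv h0).mul ?_
  simp only [Matrix.adjugate_apply]
  refine ContDiffOn.matrix_det fun k l => ?_
  by_cases hk : k = j
  · subst hk
    simpa using contDiffOn_const
  · simpa [Matrix.updateRow_ne hk] using hA k l

end MatrixSmooth

/-! ### The normalized quasi-log-likelihood -/

/-- The realized covariance `T⁻¹ ∑ Δ_i X Δ_i Xᵀ` of a path. -/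
def realizedCov {ι : Type*} (T : ℝ≥0) (n : ℕ) (x : ℝ≥0 → ι → ℝ) : Matrix ι ι ℝ :=
  (T : ℝ)⁻¹ • ∑ i ∈ Finset.range n, vecMulVec (increment T n x i) (increment T n x i)

lemma bracket_eq_sum {ι : Type*} [Fintype ι] (A B : Matrix ι ι ℝ) :
    bracket A B = ∑ i, ∑ j, A i j * B i j := by
  simp [bracket, Matrix.trace, Matrix.mul_apply]

lemma bracket_sub_left {ι : Type*} [Fintype ι] (A B C : Matrix ι ι ℝ) :
    bracket (A - B) C = bracket A C - bracket B C := by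
  simp [bracket, Matrix.sub_mul]

lemma bracket_sub_right {ι : Type*} [Fintype ι] (A B C : Matrix ι ι ℝ) :
    bracket A (B - C) = bracket A B - bracket A C := by
  simp [bracket, Matrix.mul_sub]

lemma bracket_smul_right {ι : Type*} [Fintype ι] (c : ℝ) (A B : Matrix ι ι ℝ) :
    bracket A (c • B) = c * bracket A B := by
  simp [bracket]

lemma bracket_sum_right {ι κ : Type*} [Fintype ι] (s : Finset κ) (A : Matrix ι ι ℝ)
    (B : κ → Matrix ι ι ℝ) : bracket A (∑ k ∈ s, B k) = ∑ k ∈ s, bracket A (B k) := by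
  simp [bracket, Matrix.transpose_sum, Matrix.mul_sum, Matrix.trace_sum]

namespace SEMModel

variable {D : SEMDims} (m : SEMModel D)

/-- The quasi-log-likelihood per observation, as a function of the realized covariance. -/
def rate (Q : Matrix D.Obs D.Obs ℝ) (θ : m.Param) : ℝ :=
  -(1 / 2) * (Real.log (m.cov θ).det + bracket (m.cov θ)⁻¹ Q)

lemma uniqueDiffOn_Θ : UniqueDiffOn ℝ m.Θ := uniqueDiffOn_convex m.convex_Θ m.interior_Θ

variable {m}

lemma cov_posDef {θ : m.Param} (hθ : θ ∈ m.Θ) : (m.cov θ).PosDef :=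
  (m.admissible θ hθ).cov_posDef

lemma det_cov_pos {θ : m.Param} (hθ : θ ∈ m.Θ) : 0 < (m.cov θ).det := (cov_posDef hθ).det_pos

lemma step_pos {T : ℝ≥0} (hT : 0 < T) {n : ℕ} (hn : 1 ≤ n) : 0 < (step T n : ℝ) := by
  have : (0 : ℝ≥0) < n := by exact_mod_cast hn
  exact_mod_cast div_pos hT this

lemma quasiLik_pos {T : ℝ≥0} (hT : 0 < T) {n : ℕ} (hn : 1 ≤ n) (x : ℝ≥0 → D.Obs → ℝ)
    {θ : m.Param} (hθ : θ ∈ m.Θ) : 0 < m.quasiLik T x n θ := by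
  have := step_pos hT hn
  have := det_cov_pos hθ
  unfold quasiLik
  refine Finset.prod_pos fun i _ => ?_
  positivity

/-- The prefactor in `quasiLogLik` cancels the Gaussian normalization exactly, and `1 / (2 h_n) = n
/ (2 T)` turns the sum of quadratic forms into `n / 2` times the bracket with the realized
covariance. All later analysis goes through this reduction. -/
lemma quasiLogLik_eq {T : ℝ≥0} (hT : 0 < T) {n : ℕ} (hn : 1 ≤ n) (x : ℝ≥0 → D.Obs → ℝ)
    {θ : m.Param} (hθ : θ ∈ m.Θ) :
    m.quasiLogLik T x n θ = n * m.rate (realizedCov T n x) θ := by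
  have hs := step_pos hT hn
  have hd := det_cov_pos hθ
  have hL := quasiLik_pos hT hn x hθ
  have hn' : (n : ℝ) ≠ 0 := by positivity
  have hT' : (T : ℝ) ≠ 0 := by positivity
  have hpi : 0 < 2 * Real.pi * (step T n : ℝ) := by positivity
  have hstep : (step T n : ℝ) = T / n := by simp [step]
  unfold quasiLogLik
  rw [Real.log_mul (by positivity) hL.ne', Real.log_rpow hpi]
  have : Real.log (m.quasiLik T x n θ) = ∑ i ∈ Finset.range n,
      (-((D.p : ℝ) / 2 * Real.log (2 * Real.pi * step T n)) - Real.log (m.cov θ).det / 2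
        - (n / (2 * T)) *
          bracket (m.cov θ)⁻¹ (vecMulVec (increment T n x i) (increment T n x i))) := by
    unfold quasiLik
    rw [Real.log_prod (fun i _ => by positivity)]
    refine Finset.sum_congr rfl fun i _ => ?_
    rw [Real.log_mul (by positivity) (Real.exp_pos _).ne', Real.log_exp, one_div, Real.log_inv,
      Real.log_mul (by positivity) (by positivity), Real.log_rpow hpi, Real.log_sqrt hd.le, hstep]
    field_simp
    ring
  rw [this, Finset.sum_sub_distrib, ← Finset.mul_sum, ← bracket_sum_right, rate, realizedCov,
    bracket_smul_right]
  simp only [Finset.sum_const, Finset.card_range, nsmul_eq_mul]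
  field_simp
  ring

/-- Since `rate` is affine in `Q`, replacing `Q` by the true variance leaves the limiting contrast,
plus a bracket linear in the error `Q - Σ₀`. -/
lemma rate_sub_rate (Q : Matrix D.Obs D.Obs ℝ) {θ θ₀ : m.Param} (hθ : θ ∈ m.Θ)
    (hθ₀ : θ₀ ∈ m.Θ) :
    m.rate Q θ - m.rate Q θ₀ = m.contrast θ₀ θ
      - (1 / 2) * bracket ((m.cov θ)⁻¹ - (m.cov θ₀)⁻¹) (Q - m.cov θ₀) := by
  unfold rate contrast
  rw [Real.log_div (det_cov_pos hθ).ne' (det_cov_pos hθ₀).ne']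
  simp only [bracket_sub_left, bracket_sub_right]
  ring

lemma contDiffOn_log_det : ContDiffOn ℝ 2 (fun θ => Real.log (m.cov θ).det) m.Θ :=
  (ContDiffOn.matrix_det m.smooth_cov).log fun _ hθ => (det_cov_pos hθ).ne'

lemma contDiffOn_inv_cov (a b : D.Obs) : ContDiffOn ℝ 2 (fun θ => (m.cov θ)⁻¹ a b) m.Θ :=
  ContDiffOn.matrix_inv m.smooth_cov (fun _ hθ => (det_cov_pos hθ).ne') a b

lemma contDiffOn_rate (Q : Matrix D.Obs D.Obs ℝ) : ContDiffOn ℝ 2 (m.rate Q) m.Θ := by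
  unfold rate
  simp only [bracket_eq_sum]
  exact contDiffOn_const.mul (contDiffOn_log_det.add (ContDiffOn.sum fun a _ =>
    ContDiffOn.sum fun b _ => (contDiffOn_inv_cov a b).mul contDiffOn_const))

/-- Compactness bounds the derivative within the parameter set, and convexity allows the mean value
inequality up to the boundary. -/
lemma exists_lipschitz_of_contDiffOn {f : m.Param → ℝ} (hf : ContDiffOn ℝ 2 f m.Θ) :
    ∃ C : ℝ, 0 ≤ C ∧ ∀ θ ∈ m.Θ, ∀ θ' ∈ m.Θ, |f θ - f θ'| ≤ C * ‖θ - θ'‖ := by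
  have hc := hf.continuousOn_fderivWithin m.uniqueDiffOn_Θ (by norm_num)
  obtain ⟨C, hC⟩ := m.compact_Θ.exists_bound_of_continuousOn hc
  refine ⟨max C 0, le_max_right _ _, fun θ hθ θ' hθ' => ?_⟩
  exact m.convex_Θ.norm_image_sub_le_of_norm_fderivWithin_le (hf.differentiableOn (by norm_num))
    (fun x hx => (hC x hx).trans (le_max_left _ _)) hθ' hθ

/-- The quasi-log-likelihood exceeds its value at the true parameter by at most a term that is
linear in the error of the realized covariance, minus a quadratic one. -/
lemma exists_rate_sub_rate_le {θ₀ : m.Param} (hθ₀ : θ₀ ∈ m.Θ) (hC1 : m.ConditionC1 θ₀) :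
    ∃ χ C : ℝ, 0 < χ ∧ 0 ≤ C ∧ ∀ (Q : Matrix D.Obs D.Obs ℝ) (r : ℝ),
      (∀ a b, |Q a b - m.cov θ₀ a b| ≤ r) → ∀ θ ∈ m.Θ,
        m.rate Q θ - m.rate Q θ₀ ≤ -χ * ‖θ - θ₀‖ ^ 2 + C * r * ‖θ - θ₀‖ := by
  obtain ⟨χ, hχ, hid⟩ := hC1.identifiable
  choose C hC0 hC using fun a b => exists_lipschitz_of_contDiffOn (m := m) (contDiffOn_inv_cov a b)
  refine ⟨χ, (1 / 2) * ∑ a, ∑ b, C a b, hχ, by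
    have := Finset.sum_nonneg fun a (_ : a ∈ Finset.univ) =>
      Finset.sum_nonneg fun b (_ : b ∈ Finset.univ) => hC0 a b
    positivity, fun Q r hr θ hθ => ?_⟩
  rw [rate_sub_rate Q hθ hθ₀]
  have h1 := hid θ hθ
  have h2 : -bracket ((m.cov θ)⁻¹ - (m.cov θ₀)⁻¹) (Q - m.cov θ₀) ≤
      (∑ a, ∑ b, C a b) * r * ‖θ - θ₀‖ := by
    rw [bracket_eq_sum, Finset.sum_mul, Finset.sum_mul, ← Finset.sum_neg_distrib]
    refine Finset.sum_le_sum fun a _ => ?_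
    rw [Finset.sum_mul, Finset.sum_mul, ← Finset.sum_neg_distrib]
    refine Finset.sum_le_sum fun b _ => ?_
    refine (neg_le_abs _).trans ?_
    rw [abs_mul, Matrix.sub_apply, Matrix.sub_apply]
    calc _ ≤ (C a b * ‖θ - θ₀‖) * r :=
          mul_le_mul (hC a b θ hθ θ₀ hθ₀) (hr a b) (abs_nonneg _)
            (mul_nonneg (hC0 a b) (norm_nonneg _))
      _ = _ := by ring
  linarith

lemma IsQMLE.rate_le {T : ℝ≥0} (hT : 0 < T) {n : ℕ} (hn : 1 ≤ n) {x : ℝ≥0 → D.Obs → ℝ}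
    {θ : m.Param} (h : m.IsQMLE T x n θ) {θ' : m.Param} (hθ' : θ' ∈ m.Θ) :
    m.rate (realizedCov T n x) θ' ≤ m.rate (realizedCov T n x) θ := by
  have hs := step_pos hT hn
  have h1 : m.quasiLogLik T x n θ' ≤ m.quasiLogLik T x n θ := by
    unfold quasiLogLik
    have := quasiLik_pos hT hn x hθ'
    refine Real.log_le_log (by positivity) ?_
    exact mul_le_mul_of_nonneg_left (h.2 hθ') (by positivity)
  rw [quasiLogLik_eq hT hn x hθ', quasiLogLik_eq hT hn x h.1] at h1
  exact le_of_mul_le_mul_left h1 (by positivity)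

end SEMModel

/-! ### The observed information matrix -/

/-- A `C²` function with a quadratically nondegenerate local maximum has a negative definite second
derivative there. -/
lemma fderiv_fderiv_le_of_sub_le {E : Type*} [NormedAddCommGroup E] [NormedSpace ℝ E]
    {f : E → ℝ} {x₀ : E} {χ : ℝ} (hf : ContDiffAt ℝ 2 f x₀)
    (hmax : ∀ᶠ x in 𝓝 x₀, f x - f x₀ ≤ -χ * ‖x - x₀‖ ^ 2) (v : E) :
    fderiv ℝ (fderiv ℝ f) x₀ v v ≤ -(2 * χ) * ‖v‖ ^ 2 := by
  by_contra! hlt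
  let γ : ℝ → E := fun t => x₀ + t • v
  have hγ : ∀ t, HasDerivAt γ v t := fun t => by
    simpa [γ] using ((hasDerivAt_id t).smul_const v).const_add x₀
  have hγ0 : γ 0 = x₀ := by simp [γ]
  have hγt : Tendsto γ (𝓝 0) (𝓝 x₀) := by
    simpa [hγ0] using (hγ 0).continuousAt.tendsto
  -- The quadratic correction exactly offsets the assumed decay, so `φ` still has a local maximum at
  -- `0`, whereas the negated conclusion makes its second derivative there positive.
  let φ : ℝ → ℝ := fun t => f (γ t) + χ * ‖v‖ ^ 2 * t ^ 2
  have hdf : ∀ᶠ x in 𝓝 x₀, DifferentiableAt ℝ f x := by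
    filter_upwards [hf.eventually (by simp)] with x hx using hx.differentiableAt (by norm_num)
  have hφ' : deriv φ =ᶠ[𝓝 0] fun t => fderiv ℝ f (γ t) v + 2 * (χ * ‖v‖ ^ 2) * t := by
    filter_upwards [hγt.eventually hdf] with t ht
    have h1 := ht.hasFDerivAt.comp_hasDerivAt t (hγ t)
    have h2 := ((hasDerivAt_id t).pow 2).const_mul (χ * ‖v‖ ^ 2)
    refine HasDerivAt.deriv ((h1.add h2).congr_deriv ?_)
    simp
    ring
  have hd2 : DifferentiableAt ℝ (fderiv ℝ f) x₀ :=
    (hf.fderiv_right (m := 1) (by norm_num)).differentiableAt (by norm_num)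
  have hφ'' : deriv (deriv φ) 0 = fderiv ℝ (fderiv ℝ f) x₀ v v + 2 * (χ * ‖v‖ ^ 2) := by
    rw [hφ'.deriv_eq]
    have h0 : HasFDerivAt (fderiv ℝ f) (fderiv ℝ (fderiv ℝ f) x₀) (γ 0) := by
      rw [hγ0]; exact hd2.hasFDerivAt
    have h1 := (h0.comp_hasDerivAt 0 (hγ 0)).clm_apply (hasDerivAt_const (0 : ℝ) v)
    have h2 := (hasDerivAt_id (0 : ℝ)).const_mul (2 * (χ * ‖v‖ ^ 2))
    have h3 := h1.add h2
    refine HasDerivAt.deriv (h3.congr_deriv ?_)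
    rw [map_zero, add_zero, mul_one]
  have hpos : 0 < deriv (deriv φ) 0 := by
    rw [hφ'']; linarith
  have hmaxφ : IsLocalMax φ 0 := by
    filter_upwards [hγt.eventually hmax] with t ht
    have : ‖γ t - x₀‖ ^ 2 = t ^ 2 * ‖v‖ ^ 2 := by
      simp [γ, norm_smul, mul_pow]
    rw [this] at ht
    simp only [φ, hγ0]
    nlinarith
  have hcont : ContinuousAt φ 0 := by
    have h1 : ContinuousAt f (γ 0) := by rw [hγ0]; exact hf.continuousAt
    exact (ContinuousAt.comp h1 (hγ 0).continuousAt).add (by fun_prop)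
  -- The second derivative test makes `0` a local minimum as well. Being both, `φ` is constant near
  -- `0`, so its second derivative vanishes, a contradiction.
  have hmin : IsLocalMin φ 0 := isLocalMin_of_deriv_deriv_pos hpos hmaxφ.deriv_eq_zero hcont
  have hconst : φ =ᶠ[𝓝 0] fun _ => φ 0 := by
    filter_upwards [hmaxφ, hmin] with t h1 h2 using le_antisymm h1 h2
  have h1 : deriv φ =ᶠ[𝓝 0] fun _ => 0 := by
    filter_upwards [hconst.eventuallyEq_nhds] with t ht
    rw [ht.deriv_eq, deriv_const]
  rw [h1.deriv_eq, deriv_const] at hpos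
  exact lt_irrefl _ hpos

namespace SEMModel

variable {D : SEMDims} {m : SEMModel D}

/-- The Hessian of the normalized quasi-log-likelihood. -/
def rateHessian (m : SEMModel D) (Q : Matrix D.Obs D.Obs ℝ) (θ : m.Param) :
    Matrix (Fin m.q) (Fin m.q) ℝ :=
  Matrix.of fun i j => iteratedFDerivWithin ℝ 2 (m.rate Q) m.Θ θ
    ![EuclideanSpace.single i 1, EuclideanSpace.single j 1]

lemma hessian_eq {T : ℝ≥0} (hT : 0 < T) {n : ℕ} (hn : 1 ≤ n) (x : ℝ≥0 → D.Obs → ℝ)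
    {θ : m.Param} (hθ : θ ∈ m.Θ) :
    m.hessian T x n θ = (n : ℝ) • m.rateHessian (realizedCov T n x) θ := by
  ext i j
  simp only [hessian, rateHessian, Matrix.of_apply, Matrix.smul_apply]
  have h : Set.EqOn (m.quasiLogLik T x n) ((n : ℝ) • m.rate (realizedCov T n x)) m.Θ :=
    fun θ hθ => by simpa using quasiLogLik_eq hT hn x hθ
  rw [iteratedFDerivWithin_congr h hθ, iteratedFDerivWithin_const_smul_apply
    (contDiffOn_rate _ θ hθ) m.uniqueDiffOn_Θ hθ]
  rfl

/-- Making the affine dependence on `Q` explicit, with coefficients that are continuous in `θ`, is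
what yields joint continuity in `(θ, Q)`. -/
lemma rateHessian_apply_eq (Q : Matrix D.Obs D.Obs ℝ) {θ : m.Param} (hθ : θ ∈ m.Θ)
    (v : Fin 2 → m.Param) :
    iteratedFDerivWithin ℝ 2 (m.rate Q) m.Θ θ v =
      -(1 / 2) * (iteratedFDerivWithin ℝ 2 (fun θ => Real.log (m.cov θ).det) m.Θ θ v +
        ∑ a, ∑ b, Q a b * iteratedFDerivWithin ℝ 2 (fun θ => (m.cov θ)⁻¹ a b) m.Θ θ v) := by
  have hu := m.uniqueDiffOn_Θ
  have hinv : ∀ a b, ContDiffWithinAt ℝ (2 : ℕ) (Q a b • fun θ => (m.cov θ)⁻¹ a b) m.Θ θ :=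
    fun a b => (contDiffOn_inv_cov a b θ hθ).const_smul (Q a b)
  have hrow : ∀ a, ContDiffWithinAt ℝ (2 : ℕ)
      (∑ b, Q a b • fun θ => (m.cov θ)⁻¹ a b) m.Θ θ := fun a => by
    have := ContDiffWithinAt.sum (s := Finset.univ) fun b (_ : b ∈ Finset.univ) => hinv a b
    convert this using 1
    ext; simp
  have hsum : ContDiffWithinAt ℝ (2 : ℕ)
      (∑ a, ∑ b, Q a b • fun θ => (m.cov θ)⁻¹ a b) m.Θ θ := by
    have := ContDiffWithinAt.sum (s := Finset.univ) fun a (_ : a ∈ Finset.univ) => hrow a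
    convert this using 1
    ext; simp
  have heq : m.rate Q = (-(1 / 2) : ℝ) • ((fun θ => Real.log (m.cov θ).det) +
      ∑ a, ∑ b, Q a b • fun θ => (m.cov θ)⁻¹ a b) := by
    ext θ
    simp [rate, bracket_eq_sum, mul_comm (Q _ _)]
  have hlog := contDiffOn_log_det (m := m) θ hθ
  have hadd : ContDiffWithinAt ℝ (2 : ℕ) ((fun θ => Real.log (m.cov θ).det) +
      ∑ a, ∑ b, Q a b • fun θ => (m.cov θ)⁻¹ a b) m.Θ θ := ContDiffWithinAt.add hlog hsum
  rw [heq, iteratedFDerivWithin_const_smul_apply hadd hu hθ,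
    iteratedFDerivWithin_add_apply hlog hsum hu hθ,
    iteratedFDerivWithin_sum_apply hu hθ fun a _ => hrow a]
  simp only [_root_.smul_apply, _root_.add_apply, smul_eq_mul,
    _root_.sum_apply]
  congr 2
  refine Finset.sum_congr rfl fun a _ => ?_
  rw [iteratedFDerivWithin_sum_apply hu hθ fun b _ => hinv a b,
    _root_.sum_apply]
  refine Finset.sum_congr rfl fun b _ => ?_
  rw [iteratedFDerivWithin_const_smul_apply (contDiffOn_inv_cov a b θ hθ) hu hθ]
  rfl

lemma continuousAt_det_rateHessian {θ₀ : m.Param} (hθ₀ : θ₀ ∈ interior m.Θ)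
    (Q₀ : D.Obs → D.Obs → ℝ) :
    ContinuousAt (fun z : m.Param × (D.Obs → D.Obs → ℝ) =>
      (-m.rateHessian (Matrix.of z.2) z.1).det) (θ₀, Q₀) := by
  have hΘ : m.Θ ∈ 𝓝 θ₀ := mem_interior_iff_mem_nhds.1 hθ₀
  have key : ∀ (f : m.Param → ℝ) (v : Fin 2 → m.Param), ContDiffOn ℝ 2 f m.Θ →
      ContinuousAt (fun z : m.Param × (D.Obs → D.Obs → ℝ) =>
        iteratedFDerivWithin ℝ 2 f m.Θ z.1 v) (θ₀, Q₀) := fun f v hf => by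
    have h1 := (hf.continuousOn_iteratedFDerivWithin (m := 2) le_rfl
      m.uniqueDiffOn_Θ).continuousAt hΘ
    have h2 : ContinuousAt (fun θ => iteratedFDerivWithin ℝ 2 f m.Θ θ v) θ₀ :=
      (ContinuousMultilinearMap.apply ℝ (fun _ : Fin 2 => m.Param) ℝ v).continuous.continuousAt.comp
        h1
    exact ContinuousAt.comp (f := Prod.fst) (x := (θ₀, Q₀)) h2 continuousAt_fst
  have hQ : ∀ a b, ContinuousAt (fun z : m.Param × (D.Obs → D.Obs → ℝ) => z.2 a b) (θ₀, Q₀) :=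
    fun a b => Continuous.continuousAt (by fun_prop)
  have hev : ∀ᶠ z : m.Param × (D.Obs → D.Obs → ℝ) in 𝓝 (θ₀, Q₀), z.1 ∈ m.Θ :=
    continuousAt_fst.eventually hΘ
  refine ContinuousAt.comp (g := Matrix.det) (Continuous.matrix_det continuous_id).continuousAt ?_
  refine ContinuousAt.neg ?_
  refine continuousAt_pi.2 fun i => continuousAt_pi.2 fun j => ?_
  let v : Fin 2 → m.Param := ![EuclideanSpace.single i 1, EuclideanSpace.single j 1]
  have : ContinuousAt (fun z : m.Param × (D.Obs → D.Obs → ℝ) =>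
      -(1 / 2) * (iteratedFDerivWithin ℝ 2 (fun θ => Real.log (m.cov θ).det) m.Θ z.1 v +
        ∑ a, ∑ b, z.2 a b * iteratedFDerivWithin ℝ 2 (fun θ => (m.cov θ)⁻¹ a b) m.Θ z.1 v))
      (θ₀, Q₀) :=
    continuousAt_const.mul ((key _ v contDiffOn_log_det).add (tendsto_finsetSum _ fun a _ =>
      tendsto_finsetSum _ fun b _ => (hQ a b).mul (key _ v (contDiffOn_inv_cov a b))))
  refine this.congr ?_
  filter_upwards [hev] with z hz
  exact (rateHessian_apply_eq (Matrix.of z.2) hz v).symm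

/-- At `Q = Σ₀` the rate differs from the contrast by a constant, so the quadratic identifiability
bound is a nondegenerate maximum at `θ₀`; interiority makes the within-derivatives ordinary ones. -/
lemma posDef_neg_rateHessian {θ₀ : m.Param} (hθ₀ : θ₀ ∈ interior m.Θ) (hC1 : m.ConditionC1 θ₀) :
    (-m.rateHessian (m.cov θ₀) θ₀).PosDef := by
  have hΘ : m.Θ ∈ 𝓝 θ₀ := mem_interior_iff_mem_nhds.1 hθ₀
  have hθ := interior_subset hθ₀
  obtain ⟨χ, hχ, hid⟩ := hC1.identifiable
  have hf : ContDiffAt ℝ 2 (m.rate (m.cov θ₀)) θ₀ := (contDiffOn_rate _).contDiffAt hΘ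
  have h2 : ∀ i j, m.rateHessian (m.cov θ₀) θ₀ i j =
      fderiv ℝ (fderiv ℝ (m.rate (m.cov θ₀))) θ₀ (EuclideanSpace.single i 1)
        (EuclideanSpace.single j 1) := fun i j => by
    simp only [rateHessian, Matrix.of_apply]
    rw [iteratedFDerivWithin_eq_iteratedFDeriv m.uniqueDiffOn_Θ hf hθ, iteratedFDeriv_two_apply]
    rfl
  have hsymm : IsSymmSndFDerivAt ℝ (m.rate (m.cov θ₀)) θ₀ := hf.isSymmSndFDerivAt (by simp)
  have hle := fderiv_fderiv_le_of_sub_le (χ := χ) hf (by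
    filter_upwards [hΘ] with θ hθ'
    rw [rate_sub_rate _ hθ' hθ]
    simpa [bracket] using hid θ hθ')
  refine Matrix.PosDef.of_dotProduct_mulVec_pos ?_ fun x hx => ?_
  · ext i j
    simp [h2, hsymm (EuclideanSpace.single i 1)]
  · have hv : WithLp.toLp 2 x = ∑ i, x i • EuclideanSpace.single i (1 : ℝ) := by
      ext j
      simp [Pi.single_apply]
    have h3 : fderiv ℝ (fderiv ℝ (m.rate (m.cov θ₀))) θ₀ (WithLp.toLp 2 x) (WithLp.toLp 2 x) =
        x ⬝ᵥ (m.rateHessian (m.cov θ₀) θ₀ *ᵥ x) := by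
      rw [hv]
      simp only [map_sum, map_smul, _root_.sum_apply, _root_.smul_apply,
        dotProduct, mulVec, h2, smul_eq_mul, Finset.mul_sum]
      rw [Finset.sum_comm]
      refine Finset.sum_congr rfl fun i _ => Finset.sum_congr rfl fun j _ => ?_
      ring
    have h4 := hle (WithLp.toLp 2 x)
    rw [h3] at h4
    have h5 : 0 < ‖(WithLp.toLp 2 x : m.Param)‖ := by
      rw [norm_pos_iff]
      simpa using hx
    rw [star_trivial, Matrix.neg_mulVec, dotProduct_neg]
    have : 0 < 2 * χ * ‖(WithLp.toLp 2 x : m.Param)‖ ^ 2 := by positivity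
    linarith

lemma infoMatrix_eq_or {T : ℝ≥0} (hT : 0 < T) {n : ℕ} (hn : 1 ≤ n) (x : ℝ≥0 → D.Obs → ℝ)
    {θ : m.Param} (hθ : θ ∈ m.Θ) :
    m.infoMatrix T x n θ = -m.rateHessian (realizedCov T n x) θ ∨ m.infoMatrix T x n θ = 1 := by
  have hn' : (n : ℝ) ≠ 0 := by positivity
  unfold infoMatrix
  rw [hessian_eq hT hn x hθ, smul_smul, inv_mul_cancel₀ hn', one_smul]
  split_ifs
  · exact .inl rfl
  · exact .inr rfl

/-- Near the true parameter and the true variance, the logarithm of the determinant of the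
information matrix is bounded. -/
lemma exists_abs_log_det_infoMatrix_le {θ₀ : m.Param} (hθ₀ : θ₀ ∈ interior m.Θ)
    (hC1 : m.ConditionC1 θ₀) :
    ∃ ρ K : ℝ, 0 < ρ ∧ ∀ (T : ℝ≥0) (_ : 0 < T) (n : ℕ) (_ : 1 ≤ n) (x : ℝ≥0 → D.Obs → ℝ),
      (∀ a b, |realizedCov T n x a b - m.cov θ₀ a b| < ρ) → ∀ θ ∈ m.Θ, ‖θ - θ₀‖ < ρ →
        0 < (m.infoMatrix T x n θ).det ∧ |Real.log (m.infoMatrix T x n θ).det| ≤ K := by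
  have hd := (posDef_neg_rateHessian hθ₀ hC1).det_pos
  have hc := continuousAt_det_rateHessian hθ₀ (fun a b => m.cov θ₀ a b)
  set d := (-m.rateHessian (m.cov θ₀) θ₀).det with hd_def
  have hlog : ContinuousAt (fun z : m.Param × (D.Obs → D.Obs → ℝ) =>
      Real.log (-m.rateHessian (Matrix.of z.2) z.1).det) (θ₀, fun a b => m.cov θ₀ a b) :=
    hc.log hd.ne'
  have h1 := hc.eventually (lt_mem_nhds hd)
  have h2 := hlog.abs.eventually (gt_mem_nhds (lt_add_one |Real.log d|))
  obtain ⟨ρ, hρ, hball⟩ := Metric.eventually_nhds_iff.1 (h1.and h2)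
  refine ⟨ρ, |Real.log d| + 1, hρ, fun T hT n hn x hQ θ hθ hθρ => ?_⟩
  rcases infoMatrix_eq_or hT hn x hθ with h | h
  · rw [h]
    have := hball (y := (θ, fun a b => realizedCov T n x a b)) (by
      rw [Prod.dist_eq, max_lt_iff]
      refine ⟨by simpa [dist_eq_norm] using hθρ, ?_⟩
      exact (dist_pi_lt_iff hρ).2 fun a => (dist_pi_lt_iff hρ).2 fun b => by
        simpa [Real.dist_eq] using hQ a b)
    exact ⟨this.1, this.2.le⟩
  -- The fallback value is the identity, whose log-determinant is zero, so the same bound covers it.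
  · rw [h]
    simp only [Matrix.det_one, zero_lt_one, Real.log_one, abs_zero, true_and]
    positivity

end SEMModel

/-! ### Boundedness in probability -/

section BddInProb

variable {Ω : Type*} [MeasurableSpace Ω] {P : Measure Ω}

/-- The sequence `Y n`, `n ≥ 1`, is bounded in probability. -/
def BddInProb (P : Measure Ω) (Y : ℕ → Ω → ℝ) : Prop :=
  ∀ e : ℝ≥0∞, 0 < e → ∃ K : ℝ, 0 < K ∧ ∀ n, 1 ≤ n → P {ω | K < |Y n ω|} ≤ e

namespace BddInProb

variable {Y Z : ℕ → Ω → ℝ}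

lemma mono (hZ : BddInProb P Z) (h : ∀ n, 1 ≤ n → ∀ᵐ ω ∂P, |Y n ω| ≤ |Z n ω|) :
    BddInProb P Y := fun e he => by
  obtain ⟨K, hK, hP⟩ := hZ e he
  refine ⟨K, hK, fun n hn => (measure_mono_ae ?_).trans (hP n hn)⟩
  filter_upwards [h n hn] with ω hω hY
  exact lt_of_lt_of_le hY hω

lemma add (hY : BddInProb P Y) (hZ : BddInProb P Z) :
    BddInProb P (fun n ω => Y n ω + Z n ω) := fun e he => by
  obtain ⟨K, hK, hP⟩ := hY (e / 2) (ENNReal.half_pos he.ne')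
  obtain ⟨L, hL, hQ⟩ := hZ (e / 2) (ENNReal.half_pos he.ne')
  refine ⟨K + L, by positivity, fun n hn => ?_⟩
  calc P {ω | K + L < |Y n ω + Z n ω|} ≤ P ({ω | K < |Y n ω|} ∪ {ω | L < |Z n ω|}) := by
        refine measure_mono fun ω hω => ?_
        by_contra hcon
        simp only [Set.mem_union, Set.mem_ofPred_eq, not_or, not_lt] at hcon hω
        have := abs_add_le (Y n ω) (Z n ω)
        linarith
    _ ≤ _ := measure_union_le _ _
    _ ≤ e / 2 + e / 2 := add_le_add (hP n hn) (hQ n hn)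
    _ = e := ENNReal.add_halves e

lemma abs (hY : BddInProb P Y) : BddInProb P (fun n ω => |Y n ω|) :=
  hY.mono fun _ _ => ae_of_all _ fun _ => (abs_abs _).le

lemma mul (hY : BddInProb P Y) (hZ : BddInProb P Z) :
    BddInProb P (fun n ω => Y n ω * Z n ω) := fun e he => by
  obtain ⟨K, hK, hP⟩ := hY (e / 2) (ENNReal.half_pos he.ne')
  obtain ⟨L, hL, hQ⟩ := hZ (e / 2) (ENNReal.half_pos he.ne')
  refine ⟨K * L, by positivity, fun n hn => ?_⟩
  calc P {ω | K * L < |Y n ω * Z n ω|} ≤ P ({ω | K < |Y n ω|} ∪ {ω | L < |Z n ω|}) := by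
        refine measure_mono fun ω hω => ?_
        by_contra hcon
        simp only [Set.mem_union, Set.mem_ofPred_eq, not_or, not_lt, abs_mul] at hcon hω
        have := mul_le_mul hcon.1 hcon.2 (abs_nonneg _) hK.le
        linarith
    _ ≤ _ := measure_union_le _ _
    _ ≤ e / 2 + e / 2 := add_le_add (hP n hn) (hQ n hn)
    _ = e := ENNReal.add_halves e

lemma const (c : ℝ) : BddInProb P (fun _ _ => c) := fun e _ => by
  refine ⟨|c| + 1, by positivity, fun n _ => ?_⟩
  have : {ω : Ω | |c| + 1 < |c|} = ∅ := by ext; simp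
  rw [this, measure_empty]
  exact zero_le

lemma sum {ι : Type*} (s : Finset ι) {Y : ι → ℕ → Ω → ℝ} (h : ∀ i ∈ s, BddInProb P (Y i)) :
    BddInProb P (fun n ω => ∑ i ∈ s, Y i n ω) := by
  classical
  induction s using Finset.induction_on with
  | empty => simpa using const 0
  | insert i s hi ih =>
    simp only [Finset.sum_insert hi]
    exact (h i (Finset.mem_insert_self i s)).add
      (ih fun j hj => h j (Finset.mem_insert_of_mem hj))

/-- A finite random variable is tight: the tail sets decrease to the empty set, and continuity from
above applies. It serves for the random Lipschitz constant of the drift. -/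
lemma of_aemeasurable [IsFiniteMeasure P] {Z : Ω → ℝ} (hZ : AEMeasurable Z P) :
    BddInProb P (fun _ => Z) := fun e he => by
  have hlim : Tendsto (fun k : ℕ => P {ω | (k : ℝ) < |Z ω|}) atTop (𝓝 0) := by
    have hempty : (⋂ k : ℕ, {ω | (k : ℝ) < |Z ω|}) = ∅ := by
      ext ω
      simp only [Set.mem_iInter, Set.mem_ofPred_eq, Set.mem_empty_iff_false, iff_false, not_forall,
        not_lt]
      exact exists_nat_ge _
    have := tendsto_measure_iInter_atTop (μ := P) (s := fun k : ℕ => {ω | (k : ℝ) < |Z ω|})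
      (fun k => nullMeasurableSet_lt aemeasurable_const hZ.abs)
      (fun k l hkl ω (hω : (l : ℝ) < _) => lt_of_le_of_lt (by exact_mod_cast hkl) hω)
      ⟨0, measure_ne_top _ _⟩
    rwa [hempty, measure_empty] at this
  obtain ⟨k, hk, hk0⟩ := ((hlim.eventually (gt_mem_nhds he)).and (eventually_gt_atTop 0)).exists
  exact ⟨k, by exact_mod_cast hk0, fun _ _ => hk.le⟩

lemma of_integral_sq_le [IsFiniteMeasure P] {C : ℝ} (hint : ∀ n, 1 ≤ n → MemLp (Y n) 2 P)
    (hC : ∀ n, 1 ≤ n → ∫ ω, Y n ω ^ 2 ∂P ≤ C) : BddInProb P Y := fun e he => by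
  rcases eq_or_ne e ∞ with rfl | he'
  · exact ⟨1, one_pos, fun _ _ => le_top⟩
  have hr : 0 < e.toReal := ENNReal.toReal_pos he.ne' he'
  have hC' : 0 ≤ |C| / e.toReal := by positivity
  -- Chebyshev's inequality requires `K² ≥ |C| / e`; the extra `1` keeps `K` positive even when `C =
  -- 0`.
  refine ⟨√(|C| / e.toReal) + 1, by positivity, fun n hn => ?_⟩
  set K := √(|C| / e.toReal) + 1 with hK
  have hKsq : |C| / e.toReal ≤ K ^ 2 := by
    have := Real.sq_sqrt hC'
    have := Real.sqrt_nonneg (|C| / e.toReal)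
    nlinarith
  have hK0 : 0 < K := by positivity
  have hmark := mul_meas_ge_le_integral_of_nonneg (ae_of_all P fun ω => sq_nonneg (Y n ω))
    (hint n hn).integrable_sq (K ^ 2)
  have hsub : P.real {ω | K < |Y n ω|} ≤ P.real {ω | K ^ 2 ≤ Y n ω ^ 2} := by
    refine measureReal_mono fun ω hω => ?_
    rw [Set.mem_ofPred_eq, ← sq_abs (Y n ω)]
    exact pow_le_pow_left₀ hK0.le (le_of_lt hω) 2
  have h1 : K ^ 2 * P.real {ω | K < |Y n ω|} ≤ |C| :=
    (mul_le_mul_of_nonneg_left hsub (by positivity)).trans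
      (hmark.trans ((hC n hn).trans (le_abs_self C)))
  have h2 : P.real {ω | K < |Y n ω|} ≤ e.toReal := by
    have h3 : |C| ≤ K ^ 2 * e.toReal := (div_le_iff₀ hr).1 hKsq
    exact le_of_mul_le_mul_left (h1.trans h3) (by positivity)
  exact (ENNReal.le_ofReal_iff_toReal_le (measure_ne_top _ _) hr.le).2 h2 |>.trans
    (ENNReal.ofReal_toReal he').le

end BddInProb

end BddInProb

/-! ### Quadratic covariation of Brownian motions -/

section Brownian

variable {Ω : Type*} [MeasurableSpace Ω] {P : Measure Ω}

/-- The second moment of a sum of orthogonal random variables. -/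
lemma integral_sum_sq_le {X : ℕ → Ω → ℝ} {c : ℝ} (n : ℕ) (hX : ∀ i, MemLp (X i) 2 P)
    (horth : ∀ i j, i ≠ j → ∫ ω, X i ω * X j ω ∂P = 0) (hc : ∀ i, ∫ ω, X i ω ^ 2 ∂P ≤ c) :
    ∫ ω, (∑ i ∈ Finset.range n, X i ω) ^ 2 ∂P ≤ n * c := by
  have hint : ∀ i j, Integrable (fun ω => X i ω * X j ω) P := fun i j =>
    (hX i).integrable_mul (hX j)
  simp only [sq, Finset.sum_mul_sum]
  rw [integral_finsetSum _ fun i _ => integrable_finsetSum _ fun j _ => hint i j]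
  calc ∑ i ∈ Finset.range n, ∫ ω, ∑ j ∈ Finset.range n, X i ω * X j ω ∂P
      ≤ ∑ i ∈ Finset.range n, c := by
        refine Finset.sum_le_sum fun i hi => ?_
        rw [integral_finsetSum _ fun j _ => hint i j,
          Finset.sum_eq_single_of_mem i hi fun j _ hj => horth i j hj.symm]
        simpa [sq] using hc i
    _ = n * c := by simp

variable {B C : ℝ≥0 → Ω → ℝ}

/-- The increments of a real process along the grid of mesh `T / n`. -/
def gridIncr (T : ℝ≥0) (n : ℕ) (B : ℝ≥0 → Ω → ℝ) (i : ℕ) (ω : Ω) : ℝ :=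
  B ((i + 1 : ℕ) * step T n) ω - B (i * step T n) ω

variable (T : ℝ≥0) (n : ℕ)

lemma hasLaw_gridIncr (hB : IsPreBrownianReal B P) (i : ℕ) :
    HasLaw (gridIncr T n B i) (gaussianReal 0 (step T n)) P := by
  have h := hB.hasLaw_sub ((i + 1 : ℕ) * step T n) (i * step T n)
  have hd : nndist (((i + 1 : ℕ) * step T n : ℝ≥0) : ℝ) ((i * step T n : ℝ≥0) : ℝ) = step T n := by
    ext
    rw [coe_nndist, Real.dist_eq]
    push_cast
    rw [show ((i : ℝ) + 1) * (step T n : ℝ) - i * step T n = step T n by ring]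
    exact abs_of_nonneg (step T n).2
  have h' : HasLaw (B ((i + 1 : ℕ) * step T n) - B (i * step T n))
      (gaussianReal 0 (nndist (((i + 1 : ℕ) * step T n : ℝ≥0) : ℝ)
        ((i * step T n : ℝ≥0) : ℝ))) P := h
  rw [hd] at h'
  exact h'

lemma memLp_gridIncr (hB : IsPreBrownianReal B P) (i : ℕ) {p : ℝ≥0∞} (hp : p ≠ ∞) :
    MemLp (gridIncr T n B i) p P := by
  have h := hasLaw_gridIncr T n hB i
  have := memLp_id_gaussianReal' (μ := 0) (v := step T n) p hp
  rw [← h.map_eq] at this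
  exact this.comp_of_map h.aemeasurable

lemma integral_gridIncr (hB : IsPreBrownianReal B P) (i : ℕ) :
    ∫ ω, gridIncr T n B i ω ∂P = 0 := by
  rw [(hasLaw_gridIncr T n hB i).integral_eq, integral_id_gaussianReal]

lemma integral_gridIncr_sq (hB : IsPreBrownianReal B P) (i : ℕ) :
    ∫ ω, gridIncr T n B i ω ^ 2 ∂P = step T n := by
  have h := hasLaw_gridIncr T n hB i
  have hvar := h.variance_eq
  rw [variance_id_gaussianReal, variance_of_integral_eq_zero h.aemeasurable
    (integral_gridIncr T n hB i)] at hvar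
  exact hvar

/-- Brownian scaling: an increment has the law of `√h` times a standard Gaussian. Only the order
`h²` matters below, so the fourth moment of the standard Gaussian is left unevaluated. -/
lemma integral_gridIncr_pow_four (hB : IsPreBrownianReal B P) (i : ℕ) :
    ∫ ω, gridIncr T n B i ω ^ 4 ∂P = (step T n) ^ 2 * ∫ x, x ^ 4 ∂gaussianReal 0 1 := by
  have h := (hasLaw_gridIncr T n hB i).integral_comp (f := fun x : ℝ => x ^ 4)
    (Measurable.aestronglyMeasurable (by fun_prop))
  have hmap := gaussianReal_map_const_mul (μ := 0) (v := 1) (√(step T n : ℝ))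
  have hv : NNReal.mk (√(step T n : ℝ) ^ 2) (sq_nonneg _) * 1 = step T n := by
    ext
    simp
  rw [mul_zero, hv] at hmap
  rw [← hmap, integral_map (by fun_prop) (Measurable.aestronglyMeasurable (by fun_prop))] at h
  simp only [mul_pow] at h
  rw [integral_const_mul] at h
  have hs : √(step T n : ℝ) ^ 4 = (step T n : ℝ) ^ 2 := by
    rw [show (4 : ℕ) = 2 * 2 from rfl, pow_mul, Real.sq_sqrt (NNReal.coe_nonneg _)]
  rw [hs] at h
  exact h

lemma memLp_gridIncr_mul (hB : IsPreBrownianReal B P) (hC : IsPreBrownianReal C P) (i j : ℕ) :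
    MemLp (fun ω => gridIncr T n B i ω * gridIncr T n C j ω) 2 P := by
  have : ENNReal.HolderTriple 4 4 2 := ⟨by
    rw [show (4 : ℝ≥0∞) = 2 * 2 by norm_num, ENNReal.mul_inv (by simp) (by simp), ← mul_add,
      ENNReal.inv_two_add_inv_two, mul_one]⟩
  exact (memLp_gridIncr T n hC j (by simp : (4 : ℝ≥0∞) ≠ ∞)).mul'
    (memLp_gridIncr T n hB i (by simp : (4 : ℝ≥0∞) ≠ ∞))

lemma indepFun_gridIncr (hB : IsPreBrownianReal B P) {i j : ℕ} (hij : i ≠ j) :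
    gridIncr T n B i ⟂ᵢ[P] gridIncr T n B j := by
  have hmono : Monotone fun i : ℕ => (i * step T n : ℝ≥0) := fun i j h => by
    have : (i : ℝ≥0) ≤ j := by exact_mod_cast h
    exact mul_le_mul_left this _
  exact (hB.hasIndepIncrements.nat hmono).indepFun hij

variable {T}

lemma mul_step {n : ℕ} (hn : 1 ≤ n) : (n : ℝ) * step T n = T := by
  have : (n : ℝ) ≠ 0 := by positivity
  simp [step]
  field_simp

/-- The rescaled error of the realized variance of a Brownian motion. -/
lemma bddInProb_realizedVariance [IsProbabilityMeasure P] (hB : IsPreBrownianReal B P) :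
    BddInProb P (fun n ω => √n * (∑ i ∈ Finset.range n, gridIncr T n B i ω ^ 2 - T)) := by
  let X : ℕ → ℕ → Ω → ℝ := fun n i ω => gridIncr T n B i ω ^ 2 - step T n
  have hsq : ∀ n i, MemLp (fun ω => gridIncr T n B i ω ^ 2) 2 P := fun n i => by
    simpa [sq] using memLp_gridIncr_mul T n hB hB i i
  have hX : ∀ n i, MemLp (X n i) 2 P := fun n i => (hsq n i).sub (memLp_const _)
  have heq : ∀ n : ℕ, 1 ≤ n → (fun ω => √n * (∑ i ∈ Finset.range n, gridIncr T n B i ω ^ 2 - T)) =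
      fun ω => √n * ∑ i ∈ Finset.range n, X n i ω := fun n hn => by
    ext ω
    simp only [X, Finset.sum_sub_distrib, Finset.sum_const, Finset.card_range, nsmul_eq_mul,
      mul_step hn]
  have hmean : ∀ n i, ∫ ω, X n i ω ∂P = 0 := fun n i => by
    rw [integral_sub ((hsq n i).integrable (by norm_num)) (integrable_const _),
      integral_gridIncr_sq T n hB i]
    simp
  set κ := ∫ x, x ^ 4 ∂gaussianReal 0 1 with hκ
  have hbound : ∀ n i, ∫ ω, X n i ω ^ 2 ∂P ≤ step T n ^ 2 * κ := fun n i => by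
    have hi4 : Integrable (fun ω => gridIncr T n B i ω ^ 4) P := by
      simpa [← pow_mul] using (hsq n i).integrable_sq
    have hi2 : Integrable (fun ω => gridIncr T n B i ω ^ 2) P := (hsq n i).integrable (by norm_num)
    have : ∀ ω, X n i ω ^ 2 = gridIncr T n B i ω ^ 4 - 2 * step T n * gridIncr T n B i ω ^ 2
        + step T n ^ 2 := fun ω => by simp only [X]; ring
    simp only [this]
    have hi42 : Integrable (fun ω => gridIncr T n B i ω ^ 4 -
        2 * step T n * gridIncr T n B i ω ^ 2) P := hi4.sub (hi2.const_mul _)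
    rw [integral_add hi42 (integrable_const _),
      integral_sub hi4 (hi2.const_mul _), integral_const_mul, integral_gridIncr_sq T n hB i,
      integral_gridIncr_pow_four T n hB i]
    simp only [integral_const, probReal_univ, smul_eq_mul, one_mul]
    -- The expansion gives `h² κ - 2 h² + h²`, and the negative remainder `-h²` is dropped.
    nlinarith [sq_nonneg (step T n : ℝ)]
  refine BddInProb.of_integral_sq_le (C := T ^ 2 * κ) (fun n hn => ?_) fun n hn => ?_
  · rw [heq n hn]
    exact (memLp_finsetSum _ fun i _ => hX n i).const_mul _
  · have h := integral_sum_sq_le n (hX n) (fun i j hij => ?_) (hbound n)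
    · have hT := mul_step (T := T) hn
      have h1 : ∀ ω, (√n * (∑ i ∈ Finset.range n, gridIncr T n B i ω ^ 2 - T)) ^ 2 =
          n * (∑ i ∈ Finset.range n, X n i ω) ^ 2 := fun ω => by
        rw [congrFun (heq n hn) ω, mul_pow, Real.sq_sqrt (by positivity)]
      simp only [h1]
      rw [integral_const_mul]
      calc (n : ℝ) * ∫ ω, (∑ i ∈ Finset.range n, X n i ω) ^ 2 ∂P
          ≤ n * (n * (step T n ^ 2 * κ)) := mul_le_mul_of_nonneg_left h (by positivity)
        _ = T ^ 2 * κ := by rw [← hT]; ring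
    · have hind : X n i ⟂ᵢ[P] X n j :=
        (indepFun_gridIncr T n hB hij).comp (φ := fun x => x ^ 2 - (step T n : ℝ))
          (ψ := fun x => x ^ 2 - (step T n : ℝ)) (by fun_prop) (by fun_prop)
      rw [hind.integral_fun_mul_eq_mul_integral (hX n i).aestronglyMeasurable
        (hX n j).aestronglyMeasurable, hmean, zero_mul]

/-- The rescaled realized covariance of two independent Brownian motions. -/
lemma bddInProb_realizedCovariance [IsProbabilityMeasure P] (hB : IsPreBrownianReal B P)
    (hC : IsPreBrownianReal C P)
    (hBC : IndepFun (fun ω (t : ℝ≥0) => B t ω) (fun ω (t : ℝ≥0) => C t ω) P) :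
    BddInProb P (fun n ω =>
      √n * ∑ i ∈ Finset.range n, gridIncr T n B i ω * gridIncr T n C i ω) := by
  let X : ℕ → ℕ → Ω → ℝ := fun n i ω => gridIncr T n B i ω * gridIncr T n C i ω
  have hX : ∀ n i, MemLp (X n i) 2 P := fun n i => memLp_gridIncr_mul T n hB hC i i
  have hprod : ∀ n i j, ∫ ω, X n i ω * X n j ω ∂P =
      (∫ ω, gridIncr T n B i ω * gridIncr T n B j ω ∂P) *
        ∫ ω, gridIncr T n C i ω * gridIncr T n C j ω ∂P := fun n i j => by
    -- Regroup the four factors as one functional `φ` of the path of `B` times the same functional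
    -- of the path of `C`, so that independence of the two paths factors the expectation.
    let φ : (ℝ≥0 → ℝ) → ℝ := fun w =>
      (w ((i + 1 : ℕ) * step T n) - w (i * step T n)) *
        (w ((j + 1 : ℕ) * step T n) - w (j * step T n))
    have hφ : Measurable φ := by fun_prop
    have hind := hBC.comp hφ hφ
    refine Eq.trans ?_ (IndepFun.integral_fun_mul_eq_mul_integral hind
      (memLp_gridIncr_mul T n hB hB i j).aestronglyMeasurable
      (memLp_gridIncr_mul T n hC hC i j).aestronglyMeasurable)
    refine integral_congr_ae (ae_of_all _ fun ω => ?_)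
    simp only [X, gridIncr]
    ring
  refine BddInProb.of_integral_sq_le (C := T ^ 2) (fun n hn => ?_) fun n hn => ?_
  · exact (memLp_finsetSum _ fun i _ => hX n i).const_mul _
  · have h := integral_sum_sq_le (c := step T n ^ 2) n (hX n) (fun i j hij => ?_) (fun i => ?_)
    · have hT := mul_step (T := T) hn
      have h1 : ∀ ω, (√n * ∑ i ∈ Finset.range n, gridIncr T n B i ω * gridIncr T n C i ω) ^ 2 =
          n * (∑ i ∈ Finset.range n, X n i ω) ^ 2 := fun ω => by
        rw [mul_pow, Real.sq_sqrt (by positivity)]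
      simp only [h1]
      rw [integral_const_mul]
      calc (n : ℝ) * ∫ ω, (∑ i ∈ Finset.range n, X n i ω) ^ 2 ∂P
          ≤ n * (n * (step T n ^ 2)) := mul_le_mul_of_nonneg_left h (by positivity)
        _ = T ^ 2 := by rw [← hT]; ring
    · rw [hprod, (indepFun_gridIncr T n hB hij).integral_fun_mul_eq_mul_integral
        (memLp_gridIncr T n hB i (by simp : (2 : ℝ≥0∞) ≠ ∞)).aestronglyMeasurable
        (memLp_gridIncr T n hB j (by simp : (2 : ℝ≥0∞) ≠ ∞)).aestronglyMeasurable,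
        integral_gridIncr T n hB i, zero_mul, zero_mul]
    · have := hprod n i i
      simp only [← sq] at this
      rw [this, integral_gridIncr_sq T n hB i, integral_gridIncr_sq T n hC i, sq]

end Brownian

/-! ### Processes with Lipschitz paths -/

section LipschitzPaths

variable {Ω : Type*} [MeasurableSpace Ω] {P : Measure Ω} {T : ℝ≥0}

/-- Almost every path of `A` is Lipschitz on `[0, T]`, with a measurable random constant. -/
def HasLipschitzPaths (P : Measure Ω) (T : ℝ≥0) (A : ℝ≥0 → Ω → ℝ) : Prop :=
  ∃ K : Ω → ℝ, AEMeasurable K P ∧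
    ∀ᵐ ω ∂P, ∀ s t : ℝ≥0, s ≤ t → t ≤ T → |A t ω - A s ω| ≤ K ω * ((t : ℝ) - s)

namespace HasLipschitzPaths

variable {A B : ℝ≥0 → Ω → ℝ}

lemma zero : HasLipschitzPaths P T (fun _ _ => 0) :=
  ⟨fun _ => 0, aemeasurable_const, ae_of_all _ fun _ s t _ _ => by simp⟩

lemma add (hA : HasLipschitzPaths P T A) (hB : HasLipschitzPaths P T B) :
    HasLipschitzPaths P T (fun t ω => A t ω + B t ω) := by
  obtain ⟨K, hK, hAK⟩ := hA
  obtain ⟨L, hL, hBL⟩ := hB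
  refine ⟨fun ω => K ω + L ω, hK.add hL, ?_⟩
  filter_upwards [hAK, hBL] with ω h1 h2 s t hst htT
  have h1 := h1 s t hst htT
  have h2 := h2 s t hst htT
  rw [add_sub_add_comm, add_mul]
  exact (abs_add_le _ _).trans (add_le_add h1 h2)

lemma const_mul (c : ℝ) (hA : HasLipschitzPaths P T A) :
    HasLipschitzPaths P T (fun t ω => c * A t ω) := by
  obtain ⟨K, hK, hAK⟩ := hA
  refine ⟨fun ω => |c| * K ω, hK.const_mul _, ?_⟩
  filter_upwards [hAK] with ω h1 s t hst htT
  rw [← mul_sub, abs_mul, mul_assoc]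
  exact mul_le_mul_of_nonneg_left (h1 s t hst htT) (abs_nonneg c)

lemma sum {ι : Type*} (s : Finset ι) {A : ι → ℝ≥0 → Ω → ℝ}
    (h : ∀ i ∈ s, HasLipschitzPaths P T (A i)) :
    HasLipschitzPaths P T (fun t ω => ∑ i ∈ s, A i t ω) := by
  classical
  induction s using Finset.induction_on with
  | empty => simpa using zero
  | insert i s hi ih =>
    simp only [Finset.sum_insert hi]
    exact (h i (Finset.mem_insert_self i s)).add
      (ih fun j hj => h j (Finset.mem_insert_of_mem hj))

lemma mulVec {m n : ℕ} (M : Matrix (Fin m) (Fin n) ℝ) {A : ℝ≥0 → Ω → Fin n → ℝ}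
    (h : ∀ j, HasLipschitzPaths P T (fun t ω => A t ω j)) (i : Fin m) :
    HasLipschitzPaths P T (fun t ω => (M *ᵥ A t ω) i) := by
  simpa [Matrix.mulVec, dotProduct] using sum Finset.univ fun j _ => (h j).const_mul (M i j)

end HasLipschitzPaths

/-- The drift part of a diffusion with continuous drift has Lipschitz paths. -/
lemma IsDiffusion.hasLipschitzPaths {𝓕 : Filtration ℝ≥0 ‹MeasurableSpace Ω›} {d r : ℕ}
    {b : EuclideanSpace ℝ (Fin d) → EuclideanSpace ℝ (Fin d)} {S : Matrix (Fin d) (Fin r) ℝ}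
    {c : EuclideanSpace ℝ (Fin d)} {W : ℝ≥0 → Ω → EuclideanSpace ℝ (Fin r)}
    {Z : ℝ≥0 → Ω → EuclideanSpace ℝ (Fin d)} (hZ : IsDiffusion P 𝓕 b S c W Z)
    (hb : Continuous b) (T : ℝ≥0) (j : Fin d) :
    HasLipschitzPaths P T (fun t ω => ((Z t ω).ofLp - S *ᵥ (W t ω).ofLp) j) := by
  -- The Lipschitz constant is the supremum of the drift norm over `[0, T]`. Stopping time at `T`
  -- allows the supremum to run over a countable dense subset of `ℝ≥0`, which makes it measurable;
  -- path continuity recovers all times.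
  let g : ℝ≥0 → Ω → ℝ := fun s ω => ‖b (Z (min s T) ω)‖
  refine ⟨fun ω => ⨆ k : ℕ, g (TopologicalSpace.denseSeq ℝ≥0 k) ω, ?_, ?_⟩
  · refine (Measurable.iSup fun k => ?_).aemeasurable
    have h1 : Measurable (Z (min (TopologicalSpace.denseSeq ℝ≥0 k) T)) :=
      (hZ.adapted _).mono (𝓕.le _) le_rfl
    exact (hb.measurable.comp h1).norm
  · filter_upwards [hZ.continuous_paths, hZ.sde] with ω hc hsde s t hst htT
    have hgc : Continuous fun s => g s ω := by
      have : Continuous fun s : ℝ≥0 => Z (min s T) ω :=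
        hc.comp (continuous_id.min continuous_const)
      exact (hb.comp this).norm
    have hbdd : BddAbove (Set.range fun k : ℕ => g (TopologicalSpace.denseSeq ℝ≥0 k) ω) := by
      obtain ⟨C, hC⟩ := (isCompact_Icc (a := (0 : ℝ≥0)) (b := T)).exists_bound_of_continuousOn
        (hb.comp hc).continuousOn
      refine ⟨C, ?_⟩
      rintro _ ⟨k, rfl⟩
      exact hC _ ⟨zero_le, min_le_right _ _⟩
    have hle : ∀ s, g s ω ≤ ⨆ k : ℕ, g (TopologicalSpace.denseSeq ℝ≥0 k) ω := fun s =>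
      (TopologicalSpace.denseRange_denseSeq ℝ≥0).induction_on
        (p := fun s => g s ω ≤ ⨆ k : ℕ, g (TopologicalSpace.denseSeq ℝ≥0 k) ω) s
        (isClosed_le hgc continuous_const) fun k => le_ciSup hbdd k
    have hint : ∀ u v : ℝ, IntervalIntegrable (fun s : ℝ => b (Z s.toNNReal ω)) volume u v :=
      fun u v => (hb.comp (hc.comp continuous_real_toNNReal)).intervalIntegrable u v
    have hdiff : ((Z t ω).ofLp - S *ᵥ (W t ω).ofLp) j - ((Z s ω).ofLp - S *ᵥ (W s ω).ofLp) j =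
        (∫ u in (s : ℝ)..t, b (Z u.toNNReal ω)).ofLp j := by
      rw [← intervalIntegral.integral_interval_sub_left (hint 0 t) (hint 0 s), hsde t, hsde s]
      simp
    rw [hdiff, ← Real.norm_eq_abs]
    refine (PiLp.norm_apply_le _ j).trans ?_
    have hst' : (s : ℝ) ≤ t := by exact_mod_cast hst
    have h := intervalIntegral.norm_integral_le_of_norm_le_const (a := (s : ℝ)) (b := t)
      (f := fun u : ℝ => b (Z u.toNNReal ω))
      (C := ⨆ k : ℕ, g (TopologicalSpace.denseSeq ℝ≥0 k) ω) (fun u hu => ?_)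
    · rwa [abs_of_nonneg (sub_nonneg.2 hst')] at h
    · rw [Set.uIoc_of_le hst'] at hu
      have huT : u.toNNReal ≤ T := Real.toNNReal_le_iff_le_coe.2 (hu.2.trans (by exact_mod_cast htT))
      simpa [g, min_eq_left huT] using hle u.toNNReal

end LipschitzPaths

/-! ### The observed process -/

namespace TrueSEM

variable {D : SEMDims} {Ω : Type*} [MeasurableSpace Ω] {P : Measure Ω} (S : TrueSEM D P)

/-- The stacked Wiener process. -/
def noise (t : ℝ≥0) (ω : Ω) : D.Noise → ℝ :=
  Sum.elim (Sum.elim (S.W₁ t ω).ofLp (S.W₂ t ω).ofLp) (Sum.elim (S.W₃ t ω).ofLp (S.W₄ t ω).ofLp)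

lemma isPreBrownianReal_noise (k : D.Noise) :
    IsPreBrownianReal (fun t ω => S.noise t ω k) P := by
  rcases k with (k | k) | (k | k)
  · exact (S.wiener₁.brownian k).toIsPreBrownianReal
  · exact (S.wiener₂.brownian k).toIsPreBrownianReal
  · exact (S.wiener₃.brownian k).toIsPreBrownianReal
  · exact (S.wiener₄.brownian k).toIsPreBrownianReal

omit [MeasurableSpace Ω] in
lemma comap_coord_le_pathSigma {r : ℕ} (W : ℝ≥0 → Ω → EuclideanSpace ℝ (Fin r)) (j : Fin r) :
    MeasurableSpace.comap (fun ω (t : ℝ≥0) => W t ω j) inferInstance ≤ pathSigma W := by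
  have : (fun ω (t : ℝ≥0) => W t ω j) =
      (fun (w : ℝ≥0 → EuclideanSpace ℝ (Fin r)) t => w t j) ∘ fun ω t => W t ω := rfl
  rw [this, ← MeasurableSpace.comap_comp]
  refine MeasurableSpace.comap_mono (Measurable.comap_le ?_)
  fun_prop

lemma indepFun_of_indep_pathSigma {r r' : ℕ} {W : ℝ≥0 → Ω → EuclideanSpace ℝ (Fin r)}
    {W' : ℝ≥0 → Ω → EuclideanSpace ℝ (Fin r')} (h : Indep (pathSigma W) (pathSigma W') P)
    (j : Fin r) (j' : Fin r') :
    IndepFun (fun ω (t : ℝ≥0) => W t ω j) (fun ω (t : ℝ≥0) => W' t ω j') P :=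
  (IndepFun_iff_Indep _ _ _).2 (indep_of_indep_of_le_right
    (indep_of_indep_of_le_left h (comap_coord_le_pathSigma W j)) (comap_coord_le_pathSigma W' j'))

lemma indepFun_noise {k l : D.Noise} (hkl : k ≠ l) :
    IndepFun (fun ω (t : ℝ≥0) => S.noise t ω k) (fun ω (t : ℝ≥0) => S.noise t ω l) P := by
  have h := fun i j (hij : i ≠ j) => S.indep.indep (i := i) (j := j) hij
  rcases k with (k | k) | (k | k) <;> rcases l with (l | l) | (l | l)
  · exact S.wiener₁.indep_coord.indepFun (by simpa using hkl)
  · exact indepFun_of_indep_pathSigma (h 0 1 (by decide)) k l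
  · exact indepFun_of_indep_pathSigma (h 0 2 (by decide)) k l
  · exact indepFun_of_indep_pathSigma (h 0 3 (by decide)) k l
  · exact indepFun_of_indep_pathSigma (h 1 0 (by decide)) k l
  · exact S.wiener₂.indep_coord.indepFun (by simpa using hkl)
  · exact indepFun_of_indep_pathSigma (h 1 2 (by decide)) k l
  · exact indepFun_of_indep_pathSigma (h 1 3 (by decide)) k l
  · exact indepFun_of_indep_pathSigma (h 2 0 (by decide)) k l
  · exact indepFun_of_indep_pathSigma (h 2 1 (by decide)) k l
  · exact S.wiener₃.indep_coord.indepFun (by simpa using hkl)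
  · exact indepFun_of_indep_pathSigma (h 2 3 (by decide)) k l
  · exact indepFun_of_indep_pathSigma (h 3 0 (by decide)) k l
  · exact indepFun_of_indep_pathSigma (h 3 1 (by decide)) k l
  · exact indepFun_of_indep_pathSigma (h 3 2 (by decide)) k l
  · exact S.wiener₄.indep_coord.indepFun (by simpa using hkl)

/-- Nonsingularity of `Ψ` lets the structural equation be solved for `η`, making the observed path
linear in the four diffusions. -/
lemma η_eq (t : ℝ≥0) (ω : Ω) : (S.η t ω).ofLp =
    S.coeff.Ψ⁻¹ *ᵥ (S.coeff.Γ *ᵥ (S.ξ t ω).ofLp + (S.ζ t ω).ofLp) := by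
  have h : S.coeff.Ψ *ᵥ (S.η t ω).ofLp = S.coeff.Γ *ᵥ (S.ξ t ω).ofLp + (S.ζ t ω).ofLp := by
    rw [SEMCoeff.Ψ, Matrix.sub_mulVec, Matrix.one_mulVec, sub_eq_iff_eq_add]
    nth_rewrite 1 [S.structural t ω]
    abel
  have hdet := (Matrix.isUnit_iff_isUnit_det _).1 S.admissible.Ψ_nonsing
  rw [← h, Matrix.mulVec_mulVec, Matrix.nonsing_inv_mul _ hdet, Matrix.one_mulVec]

/-- The observed process is its martingale part plus a process with Lipschitz paths. -/
lemma hasLipschitzPaths_sub_noise (hA : S.ConditionA) (T : ℝ≥0) (a : D.Obs) :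
    HasLipschitzPaths P T
      (fun t ω => S.path ω t a - (S.coeff.diffusion *ᵥ S.noise t ω) a) := by
  have hcont : ∀ {d : ℕ} {b : EuclideanSpace ℝ (Fin d) → EuclideanSpace ℝ (Fin d)}
      {Z : ℝ≥0 → Ω → EuclideanSpace ℝ (Fin d)}, DiffusionCondition P b Z → Continuous b :=
    fun h => h.smooth.1.continuous
  have hξ := S.sde_ξ.hasLipschitzPaths (hcont hA.cond_ξ) T
  have hδ := S.sde_δ.hasLipschitzPaths (hcont hA.cond_δ) T
  have hε := S.sde_ε.hasLipschitzPaths (hcont hA.cond_ε) T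
  have hζ := S.sde_ζ.hasLipschitzPaths (hcont hA.cond_ζ) T
  rcases a with a | a
  · have h := (HasLipschitzPaths.mulVec S.coeff.Λ₁ hξ a).add (hδ a)
    have heq : ∀ t ω, S.path ω t (.inl a) - (S.coeff.diffusion *ᵥ S.noise t ω) (.inl a) =
        (S.coeff.Λ₁ *ᵥ ((S.ξ t ω).ofLp - S.coeff.S₁ *ᵥ (S.W₁ t ω).ofLp)) a +
          ((S.δ t ω).ofLp - S.coeff.S₂ *ᵥ (S.W₂ t ω).ofLp) a := fun t ω => by
      simp only [path, SEMCoeff.diffusion, noise, Matrix.fromBlocks_mulVec, Sum.elim_inl,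
        Sum.elim_comp_inl, Sum.elim_comp_inr, Matrix.fromCols_mulVec_sumElim, Matrix.mulVec_sub,
        Matrix.zero_mulVec, Matrix.mulVec_mulVec, Pi.add_apply, Pi.sub_apply, Pi.zero_apply]
      ring
    simpa only [heq] using h
  · have h := ((HasLipschitzPaths.mulVec (S.coeff.Λ₂ * S.coeff.Ψ⁻¹ * S.coeff.Γ) hξ a).add
      (HasLipschitzPaths.mulVec (S.coeff.Λ₂ * S.coeff.Ψ⁻¹) hζ a)).add (hε a)
    have heq : ∀ t ω, S.path ω t (.inr a) - (S.coeff.diffusion *ᵥ S.noise t ω) (.inr a) =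
        ((S.coeff.Λ₂ * S.coeff.Ψ⁻¹ * S.coeff.Γ) *ᵥ
            ((S.ξ t ω).ofLp - S.coeff.S₁ *ᵥ (S.W₁ t ω).ofLp)) a +
          ((S.coeff.Λ₂ * S.coeff.Ψ⁻¹) *ᵥ
            ((S.ζ t ω).ofLp - S.coeff.S₄ *ᵥ (S.W₄ t ω).ofLp)) a +
          ((S.ε t ω).ofLp - S.coeff.S₃ *ᵥ (S.W₃ t ω).ofLp) a := fun t ω => by
      simp only [path, η_eq, SEMCoeff.diffusion, noise, Matrix.fromBlocks_mulVec, Sum.elim_inr,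
        Sum.elim_comp_inl, Sum.elim_comp_inr, Matrix.fromCols_mulVec_sumElim, Matrix.mulVec_sub,
        Matrix.zero_mulVec, Matrix.mulVec_mulVec, Matrix.mulVec_add, Matrix.mul_assoc,
        Pi.add_apply, Pi.sub_apply, Pi.zero_apply]
      ring
    simpa only [heq] using h

/-- The increments of the martingale part of the observed process. -/
def noiseIncr (T : ℝ≥0) (n i : ℕ) (ω : Ω) (a : D.Obs) : ℝ :=
  ∑ k, S.coeff.diffusion a k * gridIncr T n (fun t ω => S.noise t ω k) i ω

/-- The rescaled error of the realized covariance of the martingale part. -/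
lemma bddInProb_noiseIncr [IsProbabilityMeasure P] (T : ℝ≥0) (a b : D.Obs) :
    BddInProb P (fun n ω => √n * (∑ i ∈ Finset.range n, S.noiseIncr T n i ω a *
      S.noiseIncr T n i ω b - T * S.coeff.cov a b)) := by
  -- Expand bilinearly over pairs of noise coordinates. The realized covariance of coordinates `k,
  -- l` is centred at `T` if they coincide and at `0` otherwise, which reassembles `T * diffusion *
  -- diffusionᵀ`.
  have h := BddInProb.sum (P := P) Finset.univ fun k (_ : k ∈ Finset.univ) =>
    BddInProb.sum Finset.univ fun l (_ : l ∈ Finset.univ) =>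
      (BddInProb.const (P := P) (S.coeff.diffusion a k * S.coeff.diffusion b l)).mul
        (Z := fun n ω => √n * (∑ i ∈ Finset.range n, gridIncr T n (fun t ω => S.noise t ω k) i ω *
          gridIncr T n (fun t ω => S.noise t ω l) i ω - if k = l then (T : ℝ) else 0)) (by
        split_ifs with hkl
        · subst hkl
          simpa only [sq] using bddInProb_realizedVariance (S.isPreBrownianReal_noise k)
        · simpa only [sub_zero] using bddInProb_realizedCovariance (S.isPreBrownianReal_noise k)
            (S.isPreBrownianReal_noise l) (S.indepFun_noise hkl))
  refine h.mono fun n _ => ae_of_all _ fun ω => le_of_eq ?_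
  congr 1
  have hcov : S.coeff.cov a b = ∑ k, S.coeff.diffusion a k * S.coeff.diffusion b k := by
    rw [← S.coeff.diffusion_mul_transpose, Matrix.mul_apply]
    rfl
  have h1 : ∑ i ∈ Finset.range n, S.noiseIncr T n i ω a * S.noiseIncr T n i ω b =
      ∑ k, ∑ l, S.coeff.diffusion a k * S.coeff.diffusion b l *
        ∑ i ∈ Finset.range n, gridIncr T n (fun t ω => S.noise t ω k) i ω *
          gridIncr T n (fun t ω => S.noise t ω l) i ω := by
    simp only [noiseIncr, Finset.sum_mul_sum]
    rw [Finset.sum_comm]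
    refine Finset.sum_congr rfl fun k _ => ?_
    rw [Finset.sum_comm]
    refine Finset.sum_congr rfl fun l _ => ?_
    rw [Finset.mul_sum]
    refine Finset.sum_congr rfl fun i _ => ?_
    ring
  have h2 : (T : ℝ) * S.coeff.cov a b = ∑ k, ∑ l, S.coeff.diffusion a k * S.coeff.diffusion b l *
      if k = l then (T : ℝ) else 0 := by
    rw [hcov, Finset.mul_sum]
    refine Finset.sum_congr rfl fun k _ => ?_
    simp
    ring
  rw [h1, h2, ← Finset.sum_sub_distrib, Finset.mul_sum]
  refine Finset.sum_congr rfl fun k _ => ?_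
  rw [← Finset.sum_sub_distrib, Finset.mul_sum]
  refine Finset.sum_congr rfl fun l _ => ?_
  ring

/-- Here `x, y` are martingale increments and `u, v` drift increments. A bound through `∑ |x i|`
alone would require a first-moment estimate; instead `√n |z| ≤ 1 + n z²` controls the cross terms by
realized variances, which are already bounded in probability. -/
lemma abs_sum_mul_add_sub_le {n : ℕ} (hn : 1 ≤ n) {c : ℝ} {x y u v : ℕ → ℝ}
    (hu : ∀ i ∈ Finset.range n, |u i| ≤ c / n) (hv : ∀ i ∈ Finset.range n, |v i| ≤ c / n) :
    √n * |∑ i ∈ Finset.range n, (x i + u i) * (y i + v i) - ∑ i ∈ Finset.range n, x i * y i| ≤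
      c * (2 + ∑ i ∈ Finset.range n, x i * x i + ∑ i ∈ Finset.range n, y i * y i) + c ^ 2 := by
  have hn0 : (0 : ℝ) < n := by exact_mod_cast hn
  have hsn : 0 < √(n : ℝ) := Real.sqrt_pos.2 hn0
  have hsq : √(n : ℝ) * √n = n := Real.mul_self_sqrt hn0.le
  have hs1 : 1 ≤ √(n : ℝ) := Real.one_le_sqrt.2 (by exact_mod_cast hn)
  have hc : 0 ≤ c := by
    have := (abs_nonneg _).trans (hu 0 (Finset.mem_range.2 hn))
    exact (div_nonneg_iff.1 this).elim And.left fun h => absurd hn0 (not_lt.2 h.2)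
  have key : ∀ z : ℝ, √n * (|z| * (c / n)) ≤ c * (1 / n + z * z) := fun z => by
    have h1 : √n * |z| ≤ 1 + n * (z * z) := by
      have h2 : n * (z * z) = (√n * |z|) ^ 2 := by
        rw [mul_pow, sq_abs, sq, hsq, sq]
      rw [h2]
      nlinarith [sq_nonneg (√n * |z| - 1)]
    calc √n * (|z| * (c / n)) = c / n * (√n * |z|) := by ring
      _ ≤ c / n * (1 + n * (z * z)) := mul_le_mul_of_nonneg_left h1 (by positivity)
      _ = c * (1 / n + z * z) := by field_simp
  have hterm : ∀ i ∈ Finset.range n, √n * |(x i + u i) * (y i + v i) - x i * y i| ≤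
      c * (1 / n + x i * x i) + c * (1 / n + y i * y i) + c ^ 2 / n := fun i hi => by
    have h1 : |(x i + u i) * (y i + v i) - x i * y i| ≤
        |x i| * (c / n) + |y i| * (c / n) + c / n * (c / n) := by
      rw [show (x i + u i) * (y i + v i) - x i * y i = x i * v i + y i * u i + u i * v i by ring]
      refine (abs_add_three _ _ _).trans ?_
      simp only [abs_mul]
      have := hu i hi
      have := hv i hi
      gcongr
    have h2 : √n * (c / n * (c / n)) ≤ c ^ 2 / n := by
      have : √(n : ℝ) ≤ n := by nlinarith
      calc √n * (c / n * (c / n)) ≤ n * (c / n * (c / n)) :=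
            mul_le_mul_of_nonneg_right this (by positivity)
        _ = c ^ 2 / n := by field_simp
    have h3 := mul_le_mul_of_nonneg_left h1 hsn.le
    have := key (x i)
    have := key (y i)
    rw [mul_add _ (_ + _), mul_add √(n : ℝ) (|x i| * _)] at h3
    linarith
  rw [← Finset.sum_sub_distrib]
  calc √n * |∑ i ∈ Finset.range n, ((x i + u i) * (y i + v i) - x i * y i)|
      ≤ ∑ i ∈ Finset.range n, √n * |(x i + u i) * (y i + v i) - x i * y i| := by
        rw [← Finset.mul_sum]
        exact mul_le_mul_of_nonneg_left (Finset.abs_sum_le_sum_abs _ _) hsn.le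
    _ ≤ ∑ i ∈ Finset.range n, (c * (1 / n + x i * x i) + c * (1 / n + y i * y i) + c ^ 2 / n) :=
        Finset.sum_le_sum hterm
    _ = _ := by
        simp only [Finset.sum_add_distrib, ← Finset.mul_sum, Finset.sum_const, Finset.card_range,
          nsmul_eq_mul]
        field_simp
        ring

/-- The realized covariance of the observed process is `√n`-consistent. -/
lemma bddInProb_realizedCov [IsProbabilityMeasure P] (hA : S.ConditionA) {T : ℝ≥0} (hT : 0 < T)
    (a b : D.Obs) :
    BddInProb P (fun n ω => √n * (realizedCov T n (S.path ω) a b - S.coeff.cov a b)) := by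
  choose K hK hlip using S.hasLipschitzPaths_sub_noise hA T
  let c : Ω → ℝ := fun ω => T * (|K a ω| + |K b ω|)
  have hc : BddInProb P fun _ => c :=
    BddInProb.of_aemeasurable (((hK a).abs.add (hK b).abs).const_mul _)
  -- Since `√n ≥ 1`, boundedness of the rescaled error already bounds the realized variance itself.
  have hV : ∀ a, BddInProb P fun n ω =>
      ∑ i ∈ Finset.range n, S.noiseIncr T n i ω a * S.noiseIncr T n i ω a := fun a => by
    refine ((S.bddInProb_noiseIncr T a a).abs.add
      (BddInProb.const |T * S.coeff.cov a a|)).mono fun n hn => ae_of_all _ fun ω => ?_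
    set V := ∑ i ∈ Finset.range n, S.noiseIncr T n i ω a * S.noiseIncr T n i ω a
    have hs1 : 1 ≤ √(n : ℝ) := Real.one_le_sqrt.2 (by exact_mod_cast hn)
    have h1 : |V| ≤ |V - T * S.coeff.cov a a| + |T * S.coeff.cov a a| := by
      simpa using abs_add_le (V - T * S.coeff.cov a a) (T * S.coeff.cov a a)
    have h2 : |V - T * S.coeff.cov a a| ≤ |√n * (V - T * S.coeff.cov a a)| := by
      rw [abs_mul, abs_of_nonneg (Real.sqrt_nonneg _)]
      exact le_mul_of_one_le_left (abs_nonneg _) hs1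
    exact (h1.trans (add_le_add h2 le_rfl)).trans (le_abs_self _)
  have hT' : (0 : ℝ) < T := by exact_mod_cast hT
  have hbound := (BddInProb.const (P := P) (T : ℝ)⁻¹).mul
    ((hc.mul (((BddInProb.const (P := P) 2).add (hV a)).add (hV b))).add
      (hc.mul hc) |>.add (S.bddInProb_noiseIncr T a b).abs)
  refine hbound.mono fun n hn => ?_
  filter_upwards [hlip a, hlip b] with ω ha hb
  have hn0 : (0 : ℝ) < n := by exact_mod_cast hn
  let X : D.Obs → ℕ → ℝ := fun a i => S.noiseIncr T n i ω a
  -- What is left of an observed increment after removing the martingale part; the Lipschitz paths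
  -- make it `O(1/n)`.
  let U : D.Obs → ℕ → ℝ := fun a i => increment T n (S.path ω) i a - S.noiseIncr T n i ω a
  have hU : ∀ a, (∀ s t : ℝ≥0, s ≤ t → t ≤ T →
      |(S.path ω t a - (S.coeff.diffusion *ᵥ S.noise t ω) a) -
        (S.path ω s a - (S.coeff.diffusion *ᵥ S.noise s ω) a)| ≤ K a ω * ((t : ℝ) - s)) →
      ∀ i ∈ Finset.range n, |U a i| ≤ T * |K a ω| / n := fun a ha i hi => by
    have hle : ((i + 1 : ℕ) * step T n : ℝ≥0) ≤ T := by
      rw [← NNReal.coe_le_coe]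
      push_cast
      rw [← mul_step (T := T) hn]
      have : (i : ℝ) + 1 ≤ n := by exact_mod_cast Finset.mem_range.1 hi
      exact mul_le_mul_of_nonneg_right this (NNReal.coe_nonneg _)
    have hmono : (i * step T n : ℝ≥0) ≤ (i + 1 : ℕ) * step T n :=
      mul_le_mul_left (by exact_mod_cast Nat.le_succ i) _
    have h := ha _ _ hmono hle
    have hstep : (((i + 1 : ℕ) * step T n : ℝ≥0) : ℝ) - ((i * step T n : ℝ≥0) : ℝ) = T / n := by
      push_cast
      simp only [step, NNReal.coe_div, NNReal.coe_natCast]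
      ring
    have hUeq : U a i = (S.path ω ((i + 1 : ℕ) * step T n) a -
        (S.coeff.diffusion *ᵥ S.noise ((i + 1 : ℕ) * step T n) ω) a) -
        (S.path ω (i * step T n) a - (S.coeff.diffusion *ᵥ S.noise (i * step T n) ω) a) := by
      simp only [U, increment, noiseIncr, gridIncr, Matrix.mulVec, dotProduct, mul_sub,
        Finset.sum_sub_distrib, Pi.sub_apply]
      ring
    rw [hUeq]
    refine h.trans ?_
    rw [hstep]
    calc K a ω * (T / n) ≤ |K a ω| * (T / n) :=
          mul_le_mul_of_nonneg_right (le_abs_self _) (by positivity)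
      _ = T * |K a ω| / n := by ring
  have hle : ∀ i ∈ Finset.range n, |U a i| ≤ c ω / n := fun i hi =>
    (hU a ha i hi).trans (by simp only [c]; gcongr; simp)
  have hle' : ∀ i ∈ Finset.range n, |U b i| ≤ c ω / n := fun i hi =>
    (hU b hb i hi).trans (by simp only [c]; gcongr; simp)
  have hmain := abs_sum_mul_add_sub_le hn (x := X a) (y := X b) hle hle'
  have hQ : realizedCov T n (S.path ω) a b =
      (T : ℝ)⁻¹ * ∑ i ∈ Finset.range n, (X a i + U a i) * (X b i + U b i) := by
    simp [realizedCov, Matrix.sum_apply, Matrix.vecMulVec_apply, X, U]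
  have hdecomp : √n * (realizedCov T n (S.path ω) a b - S.coeff.cov a b) = (T : ℝ)⁻¹ *
      (√n * (∑ i ∈ Finset.range n, (X a i + U a i) * (X b i + U b i) -
        ∑ i ∈ Finset.range n, X a i * X b i) +
      √n * (∑ i ∈ Finset.range n, X a i * X b i - T * S.coeff.cov a b)) := by
    rw [hQ]
    field_simp
    ring
  rw [hdecomp, abs_mul, abs_mul (T : ℝ)⁻¹]
  refine mul_le_mul_of_nonneg_left ?_ (abs_nonneg _)
  refine le_trans ((abs_add_le _ _).trans (add_le_add ?_ le_rfl)) (le_abs_self _)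
  rw [abs_mul, abs_of_nonneg (Real.sqrt_nonneg _), ← sq]
  exact hmain

end TrueSEM

/-! ### Comparison of the information criteria -/

namespace SEMModel

variable {D : SEMDims} {m m' : SEMModel D}

/-- The quasi-maximum-likelihood estimator and its quasi-log-likelihood are controlled by the error
of the realized covariance. -/
lemma exists_isQMLE_control {θ₀ : m.Param} (hθ₀ : θ₀ ∈ m.Θ) (hC1 : m.ConditionC1 θ₀) :
    ∃ C : ℝ, 0 < C ∧ ∀ (T : ℝ≥0) (_ : 0 < T) (n : ℕ) (_ : 1 ≤ n) (x : ℝ≥0 → D.Obs → ℝ) (r : ℝ),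
      (∀ a b, |realizedCov T n x a b - m.cov θ₀ a b| ≤ r) → ∀ θ, m.IsQMLE T x n θ →
        m.rate (realizedCov T n x) θ - m.rate (realizedCov T n x) θ₀ ≤ C * r ^ 2 ∧
          ‖θ - θ₀‖ ≤ C * r := by
  obtain ⟨χ, C, hχ, hC, h⟩ := exists_rate_sub_rate_le hθ₀ hC1
  -- The first term is the maximum of `-χ s² + C r s` divided by `r²`. The second bounds `s / r`
  -- where that quadratic is nonnegative, as it must be at a maximizer. The `1` gives positivity.
  refine ⟨C ^ 2 / (4 * χ) + C / χ + 1, by positivity, fun T hT n hn x r hr θ hθ => ?_⟩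
  -- An observed coordinate is needed to read `0 ≤ r` off the entrywise bound.
  rcases isEmpty_or_nonempty D.Obs with hD | ⟨⟨a⟩⟩
  · exact (hD.false (.inl ⟨0, D.p₁_pos⟩)).elim
  have hr0 : 0 ≤ r := (abs_nonneg _).trans (hr a a)
  have h1 := h _ r hr θ hθ.1
  have h2 := hθ.rate_le hT hn hθ₀
  set s := ‖θ - θ₀‖ with hs
  have hs0 : 0 ≤ s := norm_nonneg _
  refine ⟨h1.trans ?_, ?_⟩
  · have h3 : -χ * s ^ 2 + C * r * s ≤ C ^ 2 / (4 * χ) * r ^ 2 := by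
      have : C ^ 2 / (4 * χ) * r ^ 2 - (-χ * s ^ 2 + C * r * s) =
          (2 * χ * s - C * r) ^ 2 / (4 * χ) := by
        field_simp
        ring
      have h4 : 0 ≤ (2 * χ * s - C * r) ^ 2 / (4 * χ) := by positivity
      linarith
    have h4 : 0 ≤ (C / χ + 1) * r ^ 2 := by positivity
    nlinarith
  · have h3 : s ≤ C / χ * r := by
      rcases hs0.eq_or_lt with h0 | hpos
      · rw [← h0]; positivity
      · have h4 : χ * s ≤ C * r := by
          have : 0 ≤ s * (C * r - χ * s) := by nlinarith
          have := nonneg_of_mul_nonneg_right this hpos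
          linarith
        rw [div_mul_eq_mul_div, le_div_iff₀ hχ]
        linarith
    have h4 : 0 ≤ (C ^ 2 / (4 * χ) + 1) * r := by positivity
    nlinarith

lemma log_det_smul_infoMatrix {T : ℝ≥0} {n : ℕ} (hn : 1 ≤ n) {x : ℝ≥0 → D.Obs → ℝ}
    {θ : m.Param} (h : 0 < (m.infoMatrix T x n θ).det) :
    Real.log ((n : ℝ) • m.infoMatrix T x n θ).det =
      m.q * Real.log n + Real.log (m.infoMatrix T x n θ).det := by
  have hn0 : (0 : ℝ) < n := by exact_mod_cast hn
  rw [Matrix.det_smul, Fintype.card_fin, Real.log_mul (by positivity) h.ne', Real.log_pow]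

/-- On paths whose realized covariance is `√n`-close to the true variance, both criteria prefer the
correctly specified model of smaller dimension, for large `n`. -/
lemma eventually_qbic_lt {θ₀ : m.Param} {θ₀' : m'.Param} (hθ₀ : θ₀ ∈ interior m.Θ)
    (hθ₀' : θ₀' ∈ interior m'.Θ) (hcov : m.cov θ₀ = m'.cov θ₀') (hC1 : m.ConditionC1 θ₀)
    (hC1' : m'.ConditionC1 θ₀') (hq : m.q < m'.q) {T : ℝ≥0} (hT : 0 < T) (L : ℝ) :
    ∀ᶠ n : ℕ in atTop, ∀ x : ℝ≥0 → D.Obs → ℝ,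
      (∀ a b, √n * |realizedCov T n x a b - m.cov θ₀ a b| ≤ L) →
      ∀ θ θ', m.IsQMLE T x n θ → m'.IsQMLE T x n θ' →
        m.qbic₁ T x n θ < m'.qbic₁ T x n θ' ∧ m.qbic₂ T x n θ < m'.qbic₂ T x n θ' := by
  obtain ⟨C, hC, hctrl⟩ := exists_isQMLE_control (interior_subset hθ₀) hC1
  obtain ⟨C', hC', hctrl'⟩ := exists_isQMLE_control (interior_subset hθ₀') hC1'
  obtain ⟨ρ, K, hρ, hinfo⟩ := exists_abs_log_det_infoMatrix_le hθ₀ hC1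
  obtain ⟨ρ', K', hρ', hinfo'⟩ := exists_abs_log_det_infoMatrix_le hθ₀' hC1'
  have hsqrt : Tendsto (fun n : ℕ => L / √(n : ℝ)) atTop (𝓝 0) :=
    (Real.tendsto_sqrt_atTop.comp tendsto_natCast_atTop_atTop).const_div_atTop L
  have hsmall : ∀ (c d : ℝ), 0 < d → ∀ᶠ n : ℕ in atTop, c * (L / √(n : ℝ)) < d := fun c d hd => by
    have := hsqrt.const_mul c
    rw [mul_zero] at this
    exact this.eventually (gt_mem_nhds hd)
  have hlog : Tendsto (fun n : ℕ => Real.log n) atTop atTop :=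
    Real.tendsto_log_atTop.comp tendsto_natCast_atTop_atTop
  -- With `r = L / √n`, the smallness conditions put `Q` and both estimators in the neighbourhoods
  -- where the information is controlled. The last threshold is twice the largest likelihood gain of
  -- the bigger model plus the two log-determinant bounds.
  filter_upwards [eventually_ge_atTop 1, hsmall 1 ρ hρ, hsmall 1 ρ' hρ', hsmall C ρ hρ,
    hsmall C' ρ' hρ', hlog.eventually (eventually_gt_atTop (2 * C' * L ^ 2 + |K| + |K'|))]
    with n hn h1 h1' h2 h2' hlogn x hx θ θ' hθ hθ'
  have hn0 : (0 : ℝ) < n := by exact_mod_cast hn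
  have hsn : 0 < √(n : ℝ) := Real.sqrt_pos.2 hn0
  have hr : ∀ a b, |realizedCov T n x a b - m.cov θ₀ a b| ≤ L / √n := fun a b => by
    rw [le_div_iff₀ hsn, mul_comm]
    exact hx a b
  have hr' : ∀ a b, |realizedCov T n x a b - m'.cov θ₀' a b| ≤ L / √n := by rwa [← hcov]
  rw [one_mul] at h1 h1'
  obtain ⟨-, hd⟩ := hctrl T hT n hn x _ hr θ hθ
  obtain ⟨hrate', hd'⟩ := hctrl' T hT n hn x _ hr' θ' hθ'
  obtain ⟨hdet, hK⟩ := hinfo T hT n hn x (fun a b => (hr a b).trans_lt h1) θ hθ.1 (hd.trans_lt h2)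
  obtain ⟨hdet', hK'⟩ := hinfo' T hT n hn x (fun a b => (hr' a b).trans_lt h1') θ' hθ'.1
    (hd'.trans_lt h2')
  -- The smaller model's maximum is at least its value at the truth, which is also the bigger
  -- model's value at the truth; so only the bigger model's gain needs an upper bound.
  have hrate := hθ.rate_le hT hn (interior_subset hθ₀)
  have heq : m.rate (realizedCov T n x) θ₀ = m'.rate (realizedCov T n x) θ₀' := by
    simp only [rate, hcov]
  have hlik : m'.quasiLogLik T x n θ' - m.quasiLogLik T x n θ ≤ C' * L ^ 2 := by
    rw [quasiLogLik_eq hT hn x hθ.1, quasiLogLik_eq hT hn x hθ'.1, ← mul_sub]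
    calc (n : ℝ) * (m'.rate (realizedCov T n x) θ' - m.rate (realizedCov T n x) θ)
        ≤ n * (C' * (L / √n) ^ 2) := mul_le_mul_of_nonneg_left (by linarith) hn0.le
      _ = C' * L ^ 2 := by
        rw [div_pow, Real.sq_sqrt hn0.le]
        field_simp
  have hqr : (m.q : ℝ) + 1 ≤ m'.q := by exact_mod_cast hq
  have hlog0 : 0 ≤ Real.log n := Real.log_nonneg (by exact_mod_cast hn)
  have hpen : (m.q : ℝ) * Real.log n + Real.log n ≤ m'.q * Real.log n := by nlinarith
  have hKa := (abs_le.1 (hK.trans (le_abs_self K))).2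
  have hKb := (abs_le.1 (hK'.trans (le_abs_self K'))).1
  have := abs_nonneg K
  have := abs_nonneg K'
  constructor
  · unfold qbic₁
    rw [log_det_smul_infoMatrix hn hdet, log_det_smul_infoMatrix hn hdet']
    linarith
  · unfold qbic₂
    linarith

end SEMModel

/-- Subadditivity `1 ≤ P E + P Eᶜ` holds for arbitrary sets, so the events comparing the criteria
need not be shown measurable. -/
lemma tendsto_measure_one_of_compl {Ω : Type*} [MeasurableSpace Ω] {P : Measure Ω}
    [IsProbabilityMeasure P] {E : ℕ → Set Ω}
    (h : ∀ e : ℝ≥0∞, 0 < e → ∀ᶠ n in atTop, P (E n)ᶜ ≤ e) :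
    Tendsto (fun n => P (E n)) atTop (𝓝 1) := by
  have h0 : Tendsto (fun n => P (E n)ᶜ) atTop (𝓝 0) := ENNReal.tendsto_nhds_zero.2 h
  have h1 : Tendsto (fun n => 1 - P (E n)ᶜ) atTop (𝓝 1) := by
    simpa using ENNReal.Tendsto.sub tendsto_const_nhds h0 (.inl ENNReal.one_ne_top)
  refine tendsto_of_tendsto_of_tendsto_of_le_of_le h1 tendsto_const_nhds (fun n => ?_)
    fun n => prob_le_one
  rw [tsub_le_iff_right, ← measure_univ (μ := P), ← Set.union_compl_self (E n)]
  exact measure_union_le _ _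

end
theorem theorem2 {Ω : Type*} [MeasurableSpace Ω] (P : Measure Ω) [IsProbabilityMeasure P]
    (D : SEMDims) (S : TrueSEM D P) (T : ℝ≥0) (hT : 0 < T)
    (M : ℕ) (model : Fin M → SEMModel D)
    (θ₀ : ∀ i, (model i).Param)
    (hθ₀ : ∀ i, (model i).CorrectlySpecified S.coeff.cov →
      θ₀ i ∈ interior (model i).Θ ∧ S.coeff.cov = (model i).cov (θ₀ i))
    (π : ∀ i, ℕ → (model i).Param → ℝ)
    (hπ : ∀ i n, 1 ≤ n → (model i).IsPriorDensity (π i n))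
    (θhat : ∀ i, ℕ → Ω → (model i).Param)
    (hθhat_meas : ∀ i n, Measurable (θhat i n))
    (hθhat : ∀ i n, 1 ≤ n → ∀ᵐ ω ∂P, (model i).IsQMLE T (S.path ω) n (θhat i n ω))
    (hA : S.ConditionA)
    (hB : ∀ i, (model i).CorrectlySpecified S.coeff.cov → (model i).ConditionB (π i) (θ₀ i))
    (hC1 : ∀ i, (model i).CorrectlySpecified S.coeff.cov → (model i).ConditionC1 (θ₀ i))
    (mstar m : Fin M)
    (hmstar : IsOptimalModel model S.coeff.cov mstar)
    (hm : (model m).CorrectlySpecified S.coeff.cov) (hne : m ≠ mstar)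
    (hnested : SEMModel.NestedIn P T S.path (model mstar) (model m)) :
    Tendsto (fun n : ℕ => P {ω |
        (model mstar).qbic₁ T (S.path ω) n (θhat mstar n ω) <
          (model m).qbic₁ T (S.path ω) n (θhat m n ω)}) atTop (𝓝 1) ∧
      Tendsto (fun n : ℕ => P {ω |
        (model mstar).qbic₂ T (S.path ω) n (θhat mstar n ω) <
          (model m).qbic₂ T (S.path ω) n (θhat m n ω)}) atTop (𝓝 1) := by

  obtain ⟨hθs, hcovs⟩ := hθ₀ mstar hmstar.1
  obtain ⟨hθm, hcovm⟩ := hθ₀ m hm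
  have hbdd : BddInProb P fun n ω =>
      ∑ a, ∑ b, |√n * (realizedCov T n (S.path ω) a b - S.coeff.cov a b)| :=
    BddInProb.sum _ fun a _ => BddInProb.sum _ fun b _ => (S.bddInProb_realizedCov hA hT a b).abs
  -- Both inequalities hold on the same good paths, so a single event serves: almost surely, its
  -- failure forces the summed rescaled error of the realized covariance above `L`.
  have hbad : ∀ e : ℝ≥0∞, 0 < e → ∀ᶠ n : ℕ in atTop, P {ω |
      (model mstar).qbic₁ T (S.path ω) n (θhat mstar n ω) <
          (model m).qbic₁ T (S.path ω) n (θhat m n ω) ∧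
        (model mstar).qbic₂ T (S.path ω) n (θhat mstar n ω) <
          (model m).qbic₂ T (S.path ω) n (θhat m n ω)}ᶜ ≤ e := fun e he => by
    obtain ⟨L, -, hL⟩ := hbdd e he
    filter_upwards [eventually_ge_atTop 1, SEMModel.eventually_qbic_lt hθs hθm
      (hcovs.symm.trans hcovm) (hC1 mstar hmstar.1) (hC1 m hm) hnested.1 hT L] with n hn hlt
    refine (measure_mono_ae ?_).trans (hL n hn)
    filter_upwards [hθhat mstar n hn, hθhat m n hn] with ω h1 h2 hω
    by_contra hcon
    refine hω (hlt (S.path ω) (fun a b => ?_) _ _ h1 h2)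
    have hsum : ∑ a, ∑ b, |√n * (realizedCov T n (S.path ω) a b - S.coeff.cov a b)| ≤ L :=
      (le_abs_self _).trans (not_lt.1 hcon)
    have hle : |√n * (realizedCov T n (S.path ω) a b - S.coeff.cov a b)| ≤ L :=
      ((Finset.single_le_sum (f := fun b =>
        |√n * (realizedCov T n (S.path ω) a b - S.coeff.cov a b)|)
        (fun b _ => abs_nonneg _) (Finset.mem_univ b)).trans
        (Finset.single_le_sum (f := fun a => ∑ b,
          |√n * (realizedCov T n (S.path ω) a b - S.coeff.cov a b)|)
          (fun a _ => Finset.sum_nonneg fun b _ => abs_nonneg _) (Finset.mem_univ a))).trans hsum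
    rwa [abs_mul, abs_of_nonneg (Real.sqrt_nonneg _), hcovs] at hle
  constructor <;> refine tendsto_measure_one_of_compl fun e he => ?_
  · filter_upwards [hbad e he] with n hn
    exact (measure_mono (Set.compl_subset_compl.2 fun ω hω => hω.1)).trans hn
  · filter_upwards [hbad e he] with n hn
    exact (measure_mono (Set.compl_subset_compl.2 fun ω hω => hω.2)).trans hn
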